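/- All algorithms are deterministic Word-RAM programs with words of $O(\log N)$ bits ($N$ being the length of the input in words plus its largest entry), and running time is the worst-case number of executed instructions. The *$k$-cycle hypothesis* says: for every $\varepsilon>0$ there is some $k$ such that no $O(m^{2-\varepsilon})$-time algorithm decides whether a given directed graph with $m$ edges, presented by its list of edges, contains a $k$-cycle (distinct vertices $v_0,\dots,v_{k-1}$ with an edge from $v_i$ to $v_{i+1 \bmod k}$ for every $i$). A *unary $1$-VASS* $\mathcal V=(Q,T)$ consists of a non-empty finite set $Q$ of states and a non-empty set $T\subseteq Q\times\{-1,0,1\}\times Q$ of transitions; its size is $n=|Q|+|T|$. For a bound $B$, a configuration is a pair $q(v)$ with $q\in Q$ and $v\in\{0,\dots,B\}$; there is a step from $p(u)$ to $q(v)$ if $(p,v-u,q)\in T$, and a run is a finite sequence of configurations linked by steps. For a function $B(n)$, an instance of *reachability* (respectively *coverability*) in unary $(B(n),1)$-VASS consists of a unary $1$-VASS of size $n$ and two configurations $p(u)$, $q(v)$ with $u,v\in\{0,\dots,B(n)\}$; it asks whether there is a run, with all counter values in $\{0,\dots,B(n)\}$, from $p(u)$ to $q(v)$ (respectively to $q(v')$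 for some $v'\ge v$). The bound is not part of the input. **Theorem.** Assume the $k$-cycle hypothesis. Then for every rational constant $\gamma>0$ and every $\varepsilon>0$ there is no $O(n^{2-\varepsilon})$-time algorithm that decides reachability, and no $O(n^{2-\varepsilon})$-time algorithm that decides coverability, in unary $(\lfloor\gamma n\rfloor,1)$-VASS of size $n$. -/

import Mathlib

/-! ## Word-RAM -/

namespace WordRAM

/-- Unit-cost binary operations on words (`sub` is truncated at `0`; `shl`, `shr` are shifts). -/
inductive BinOp where
  | add | sub | mul | div | mod | and | or | xor | shl | shr

def BinOp.eval : BinOp → ℕ → ℕ → ℕ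
  | .add, a, b => a + b
  | .sub, a, b => a - b
  | .mul, a, b => a * b
  | .div, a, b => a / b
  | .mod, a, b => a % b
  | .and, a, b => a &&& b
  | .or, a, b => a ||| b
  | .xor, a, b => a ^^^ b
  | .shl, a, b => a <<< b
  | .shr, a, b => a >>> b

/-- Instructions. `R[·]` are the registers, `M[·]` is the random access memory.
A program mentions only finitely many registers. -/
inductive Instr where
  /-- `R[d] := v` -/
  | const (d v : ℕ)
  /-- `R[d] := o (R[a], R[b])` -/
  | binop (o : BinOp) (d a b : ℕ)
  /-- `R[d] := M[R[a]]` -/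
  | load (d a : ℕ)
  /-- `M[R[a]] := R[b]` -/
  | store (a b : ℕ)
  /-- continue with instruction number `l` -/
  | jump (l : ℕ)
  /-- continue with instruction number `l` if `R[a] = 0` -/
  | jumpZero (a l : ℕ)
  | accept
  | reject

/-- A (deterministic) program: a finite list of instructions. -/
abbrev Program := List Instr

/-- A machine state: program counter, registers, memory. -/
structure State where
  pc : ℕ
  reg : ℕ → ℕ
  mem : ℕ → ℕ

/-- Write `v` into register `d` and go to the next instruction. Registers hold `w`-bit words:
a value that does not fit into a word leaves the machine without a successor state. -/
def State.setReg (w : ℕ) (s : State) (d v : ℕ) : Option State :=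
  if v < 2 ^ w then some ⟨s.pc + 1, Function.update s.reg d v, s.mem⟩ else none

/-- Execute one instruction with `w`-bit words (`accept` and `reject` have no successor). -/
def Instr.exec (w : ℕ) (s : State) : Instr → Option State
  | .const d v => s.setReg w d v
  | .binop o d a b => s.setReg w d (o.eval (s.reg a) (s.reg b))
  | .load d a => s.setReg w d (s.mem (s.reg a))
  | .store a b => some ⟨s.pc + 1, s.reg, Function.update s.mem (s.reg a) (s.reg b)⟩
  | .jump l => some ⟨l, s.reg, s.mem⟩
  | .jumpZero a l => some ⟨if s.reg a = 0 then l else s.pc + 1, s.reg, s.mem⟩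
  | .accept => none
  | .reject => none

/-- `run P w t s = some b`: started in state `s`, the program `P` on a machine with `w`-bit words
halts after executing at most `t` instructions, with answer `b`. -/
def run (P : Program) (w : ℕ) : ℕ → State → Option Bool
  | 0, _ => none
  | t + 1, s =>
    match P[s.pc]? with
    | none => none
    | some .accept => some true
    | some .reject => some false
    | some i => (i.exec w s).bind (run P w t)

/-- Initial state: the input list is in the first memory cells, everything else is `0`. -/
def initial (L : List ℕ) : State := ⟨0, fun _ => 0, fun i => L.getD i 0⟩

/-- The number of bits needed to write down the length of the input plus its largest entry. -/
def inputBits (L : List ℕ) : ℕ := Nat.size (L.length + L.foldr max 0)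

end WordRAM

/-- A decision problem: a type of instances, how an instance is presented as a list of words, the
parameter in which running times are measured, and the yes-instances. -/
structure DecisionProblem where
  Inst : Type
  encode : Inst → List ℕ
  size : Inst → ℕ
  yes : Inst → Prop

/-- Some deterministic Word-RAM program with words of `O(log n)` bits decides the problem,
executing at most `T (size x)` instructions on every instance `x`. -/
def DecisionProblem.SolvableInTime (D : DecisionProblem) (T : ℕ → ℕ) : Prop :=
  ∃ (P : WordRAM.Program) (c : ℕ), ∀ x : D.Inst, ∃ b : Bool,
    WordRAM.run P (c * WordRAM.inputBits (D.encode x)) (T (D.size x))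
      (WordRAM.initial (D.encode x)) = some b ∧ (b = true ↔ D.yes x)

/-- The problem has an `O(n ^ a)`-time algorithm, `n` being the size of the instance. -/
def DecisionProblem.SolvableInTimeBigO (D : DecisionProblem) (a : ℝ) : Prop :=
  ∃ T : ℕ → ℕ,
    Asymptotics.IsBigO Filter.atTop (fun n : ℕ => (T n : ℝ)) (fun n : ℕ => (n : ℝ) ^ a) ∧
      D.SolvableInTime T

/-! ## Cycles in directed graphs -/

/-- A `k`-cycle: distinct vertices `c 0, …, c (k - 1)` with edges from `c i` to
`c (i + 1 mod k)`. -/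
def Digraph.HasKCycle {V : Type*} (G : Digraph V) (k : ℕ) : Prop :=
  ∃ c : Fin k → V, Function.Injective c ∧
    ∀ i j : Fin k, (j : ℕ) = ((i : ℕ) + 1) % k → G.Adj (c i) (c j)

/-- A directed graph on finitely many vertices together with the order in which its edges are
listed in the input. -/
structure GraphInput where
  numVertices : ℕ
  graph : Digraph (Fin numVertices)
  edges : List (Fin numVertices × Fin numVertices)
  nodup : edges.Nodup
  mem_edges : ∀ u v, (u, v) ∈ edges ↔ graph.Adj u v

/-- Number of vertices, number of edges, and the two endpoints of each edge. -/
def GraphInput.encode (x : GraphInput) : List ℕ :=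
  [x.numVertices, x.edges.length] ++ x.edges.flatMap fun e => [(e.1 : ℕ), (e.2 : ℕ)]

/-- Does a given directed graph contain a `k`-cycle? Measured in the number of edges. -/
def kCycleProblem (k : ℕ) : DecisionProblem where
  Inst := GraphInput
  encode := GraphInput.encode
  size x := x.edges.length
  yes x := x.graph.HasKCycle k

/-- The `k`-cycle hypothesis: for every `ε > 0` there is some `k` such that no
`O(m ^ (2 - ε))`-time algorithm finds `k`-cycles in directed graphs with `m` edges. -/
def KCycleHypothesis : Prop :=
  ∀ ε : ℝ, 0 < ε → ∃ k : ℕ, ¬ (kCycleProblem k).SolvableInTimeBigO (2 - ε)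

/-! ## Bounded unary VASS -/

/-- A unary `d`-dimensional vector addition system with states `Q`: a non-empty finite set of
transitions, all of whose updates are in `{-1, 0, 1}^d`. -/
structure UnaryVASS (d : ℕ) (Q : Type*) where
  trans : Finset (Q × (Fin d → ℤ) × Q)
  nonempty : trans.Nonempty
  unary : ∀ t ∈ trans, ∀ i, t.2.1 i = -1 ∨ t.2.1 i = 0 ∨ t.2.1 i = 1

namespace UnaryVASS

variable {d : ℕ} {Q : Type*}

/-- The size `|Q| + |T|`. -/
def size [Fintype Q] (V : UnaryVASS d Q) : ℕ := Fintype.card Q + V.trans.card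

/-- One step between configurations all of whose counter values are in `{0, …, B}`. -/
def BStep (V : UnaryVASS d Q) (B : ℕ) (c c' : Q × (Fin d → ℕ)) : Prop :=
  (∀ i, c.2 i ≤ B) ∧ (∀ i, c'.2 i ≤ B) ∧
    ∃ x : Fin d → ℤ, (c.1, x, c'.1) ∈ V.trans ∧ ∀ i, x i = (c'.2 i : ℤ) - (c.2 i : ℤ)

/-- There is a run from `c` to `c'` whose counter values stay in `{0, …, B}`. -/
def BReach (V : UnaryVASS d Q) (B : ℕ) (c c' : Q × (Fin d → ℕ)) : Prop :=
  Relation.ReflTransGen (V.BStep B) c c'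

end UnaryVASS

/-- An instance of reachability or coverability in unary `(B(n), d)`-VASS: a unary `d`-VASS of
some size `n`, an initial configuration and a target configuration with counter values in
`{0, …, B(n)}`, and the order in which the transitions are listed in the input. -/
structure BoundedVASSInput (B : ℕ → ℕ) (d : ℕ) where
  numStates : ℕ
  vass : UnaryVASS d (Fin numStates)
  source : Fin numStates × (Fin d → ℕ)
  target : Fin numStates × (Fin d → ℕ)
  source_le : ∀ i, source.2 i ≤ B vass.size
  target_le : ∀ i, target.2 i ≤ B vass.size
  transList : List (Fin numStates × (Fin d → ℤ) × Fin numStates)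
  nodup : transList.Nodup
  mem_transList : ∀ t, t ∈ transList ↔ t ∈ vass.trans

/-- Number of states, number of transitions, the two configurations, and the transitions, where
an update `-1`, `0`, `1` is written as `0`, `1`, `2`. -/
def BoundedVASSInput.encode {B : ℕ → ℕ} {d : ℕ} (x : BoundedVASSInput B d) : List ℕ :=
  [x.numStates, x.transList.length] ++
    ((x.source.1 : ℕ) :: List.ofFn x.source.2) ++ ((x.target.1 : ℕ) :: List.ofFn x.target.2) ++
    x.transList.flatMap fun t =>
      (t.1 : ℕ) :: (List.ofFn (fun i => (t.2.1 i + 1).toNat) ++ [(t.2.2 : ℕ)])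

/-- Reachability in unary `(B(n), d)`-VASS of size `n`; the bound is not part of the input. -/
def reachabilityProblem (B : ℕ → ℕ) (d : ℕ) : DecisionProblem where
  Inst := BoundedVASSInput B d
  encode := BoundedVASSInput.encode
  size x := x.vass.size
  yes x := x.vass.BReach (B x.vass.size) x.source x.target

/-- Coverability in unary `(B(n), d)`-VASS of size `n`; the bound is not part of the input. -/
def coverabilityProblem (B : ℕ → ℕ) (d : ℕ) : DecisionProblem where
  Inst := BoundedVASSInput B d
  encode := BoundedVASSInput.encode
  size x := x.vass.size
  yes x := ∃ v : Fin d → ℕ, (∀ i, x.target.2 i ≤ v i) ∧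
    x.vass.BReach (B x.vass.size) x.source (x.target.1, v)

/-- The linear counter bound `n ↦ ⌊γ n⌋`. -/
def linearBound (γ : ℚ) (n : ℕ) : ℕ := ⌊γ * (n : ℚ)⌋₊

/-!
Colour the vertices so that every `k`-tuple of distinct vertices is coloured with distinct positions
by one of the colourings; testing bits of the numbers of the vertices provides polylogarithmically
many colourings that suffice. A `k`-cycle is then the same as a closed walk through `k + 1` copies
of the set of `G` coloured vertices, from some coloured vertex `g` of the first copy to the same `g`
in the last one, where step `i` uses only vertices of colour `i`.

A counter with bound `B ≥ G` recognises such walks. Start in the first copy with the maximal value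
`B`, decrease the counter on the way to vertex `g`, follow the walk without changing the counter,
and increase it on the way from vertex `g'` of the last copy to the end. The value `B` is reached
again only if `g ≤ g'`, and the bound `B` forbids `g < g'`. Hence reachability and coverability both
detect closed walks. As `G` is `O(m ^ (1 + δ))` for every `δ > 0`, the VASS is almost as small as
the graph, and spare states ensure that `B ≥ G`.
-/

namespace WordRAM

/-! ## Fragments of programs -/

/-- `P` started in `s` behaves after `t` steps as if started in `s'`. -/
def Leads (P : Program) (w t : ℕ) (s s' : State) : Prop :=
  ∀ t', run P w (t + t') s = run P w t' s'

theorem Leads.trans {P : Program} {w t₁ t₂ : ℕ} {s₁ s₂ s₃ : State} (h₁ : Leads P w t₁ s₁ s₂)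
    (h₂ : Leads P w t₂ s₂ s₃) : Leads P w (t₁ + t₂) s₁ s₃ := fun t' => by
  rw [Nat.add_assoc, h₁, h₂]

theorem Leads.step {P : Program} {w : ℕ} {s s' : State} {i : Instr} (hi : P[s.pc]? = some i)
    (he : i.exec w s = some s') : Leads P w 1 s s' := fun t' => by
  rw [Nat.add_comm, run, hi]
  cases i <;> first | exact congrArg (Option.bind · _) he | simp [Instr.exec] at he

theorem run_mono {P : Program} {w t t' : ℕ} {s : State} {b : Bool} (htt' : t ≤ t')
    (h : run P w t s = some b) : run P w t' s = some b := by
  induction t generalizing s t' with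
  | zero => simp [run] at h
  | succ t ih =>
    obtain ⟨t', rfl⟩ := Nat.exists_eq_add_of_le' (Nat.zero_lt_of_lt htt')
    rw [run] at h ⊢
    split at h
    · simp at h
    · exact h
    · exact h
    · obtain ⟨s', hs', h⟩ := Option.bind_eq_some_iff.1 h
      rw [hs']
      exact ih (Nat.le_of_succ_le_succ htt') h

/-- The instructions `l` stand in `P` from instruction number `o` on. -/
def CodeAt (P : Program) (o : ℕ) (l : List Instr) : Prop :=
  l <+: P.drop o

namespace CodeAt

variable {P : Program} {o : ℕ} {i : Instr} {l l₁ l₂ : List Instr}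

theorem left (h : CodeAt P o (l₁ ++ l₂)) : CodeAt P o l₁ :=
  (List.prefix_append l₁ l₂).trans h

theorem right (h : CodeAt P o (l₁ ++ l₂)) : CodeAt P (o + l₁.length) l₂ := by
  simpa [CodeAt, Nat.add_comm] using List.IsPrefix.drop h l₁.length

theorem head (h : CodeAt P o (i :: l)) : P[o]? = some i := by
  obtain ⟨l', hl'⟩ := h
  rw [← Nat.add_zero o, ← List.getElem?_drop, ← hl']
  rfl

theorem tail (h : CodeAt P o (i :: l)) : CodeAt P (o + 1) l :=
  right (l₁ := [i]) h

end CodeAt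

/-! ## A while language -/

section WhileLanguage

variable {V : Type*}

/-- Expressions over the variables `V`; `load e` is the content of the memory cell `e`. Left shifts
are excluded because their results can be longer than any multiple of the length of a word. -/
inductive Expr (V : Type*) where
  | lit (n : ℕ)
  | var (x : V)
  | load (e : Expr V)
  | bin (o : BinOp) (ho : o ≠ .shl) (a b : Expr V)

/-- Programs of the while language; `store a e` writes `e` to the memory cell `a`, and `loop e b`
repeats `b` as long as `e` is not `0`. -/
inductive Cmd (V : Type*) where
  | assign (x : V) (e : Expr V)
  | store (a e : Expr V)
  | seq (b c : Cmd V)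
  | loop (e : Expr V) (b : Cmd V)

/-- The values of the variables and the content of the memory. -/
@[ext]
structure Store (V : Type*) where
  var : V → ℕ
  mem : ℕ → ℕ

/-- Change the value of a variable. -/
def Store.set [DecidableEq V] (σ : Store V) (x : V) (v : ℕ) : Store V :=
  ⟨Function.update σ.var x v, σ.mem⟩

/-- Change the content of a memory cell. -/
def Store.write (σ : Store V) (a v : ℕ) : Store V :=
  ⟨σ.var, Function.update σ.mem a v⟩

/-- All variables and memory cells hold `c`-bit words. -/
structure Store.Bounded (c : ℕ) (σ : Store V) : Prop where
  var_lt (x : V) : σ.var x < 2 ^ c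
  mem_lt (a : ℕ) : σ.mem a < 2 ^ c

theorem Store.Bounded.set [DecidableEq V] {c : ℕ} {σ : Store V} (h : σ.Bounded c) (x : V) {v : ℕ}
    (hv : v < 2 ^ c) : (σ.set x v).Bounded c where
  var_lt y := by
    by_cases hy : y = x
    · simpa [Store.set, hy] using hv
    · simpa [Store.set, hy] using h.var_lt y
  mem_lt := h.mem_lt

theorem Store.Bounded.write {c : ℕ} {σ : Store V} (h : σ.Bounded c) (a : ℕ) {v : ℕ}
    (hv : v < 2 ^ c) : (σ.write a v).Bounded c where
  var_lt := h.var_lt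
  mem_lt b := by
    by_cases hb : b = a
    · simpa [Store.write, hb] using hv
    · simpa [Store.write, hb] using h.mem_lt b

theorem BinOp.eval_lt {o : BinOp} (ho : o ≠ .shl) {a b i j : ℕ} (ha : a < 2 ^ i) (hb : b < 2 ^ j) :
    o.eval a b < 2 ^ (i + j) := by
  have hab : a + b < 2 ^ (i + j) := by
    rw [Nat.pow_add]
    nlinarith
  have hi : 2 ^ i ≤ 2 ^ (i + j) := Nat.pow_le_pow_right two_pos (Nat.le_add_right i j)
  have hj : 2 ^ j ≤ 2 ^ (i + j) := Nat.pow_le_pow_right two_pos (Nat.le_add_left j i)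
  cases o with
  | add => exact hab
  | sub => exact (Nat.sub_le a b).trans_lt (ha.trans_le hi)
  | mul => exact (Nat.mul_lt_mul'' ha hb).trans_eq (Nat.pow_add 2 i j).symm
  | div => exact (Nat.div_le_self a b).trans_lt (ha.trans_le hi)
  | mod => exact (Nat.mod_le a b).trans_lt (ha.trans_le hi)
  | and => exact Nat.and_le_left.trans_lt (ha.trans_le hi)
  | or => exact Nat.or_lt_two_pow (ha.trans_le hi) (hb.trans_le hj)
  | xor => exact Nat.xor_lt_two_pow (ha.trans_le hi) (hb.trans_le hj)
  | shl => exact absurd rfl ho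
  | shr => exact (Nat.shiftRight_le a b).trans_lt (ha.trans_le hi)

namespace Expr

/-- The value of an expression. -/
def eval (σ : Store V) : Expr V → ℕ
  | lit n => n
  | var x => σ.var x
  | load e => σ.mem (e.eval σ)
  | bin o _ a b => o.eval (a.eval σ) (b.eval σ)

/-- The number of operations in an expression, which is the time it takes to evaluate it. -/
def len : Expr V → ℕ
  | lit _ => 1
  | var _ => 1
  | load e => e.len + 1
  | bin _ _ a b => a.len + b.len + 1

/-- The number of bits in which all intermediate values of an expression fit when the variables
and the memory cells hold `c`-bit words. -/
def bits (c : ℕ) : Expr V → ℕ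
  | lit n => n.size
  | var _ => c
  | load e => max c (e.bits c)
  | bin _ _ a b => a.bits c + b.bits c

theorem eval_lt {c : ℕ} {σ : Store V} (hσ : σ.Bounded c) (e : Expr V) :
    e.eval σ < 2 ^ e.bits c := by
  induction e with
  | lit n => exact Nat.lt_size_self n
  | var x => exact hσ.var_lt x
  | load e _ => exact (hσ.mem_lt _).trans_le (Nat.pow_le_pow_right two_pos (le_max_left _ _))
  | bin o ho a b iha ihb => exact BinOp.eval_lt ho iha ihb

theorem bits_le {c : ℕ} (hc : 1 ≤ c) (e : Expr V) : e.bits c ≤ e.bits 1 * c := by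
  induction e with
  | lit n => exact Nat.le_mul_of_pos_right _ hc
  | var _ => exact (Nat.one_mul c).ge
  | load e ih =>
    rw [bits, bits, ← Nat.mul_max_mul_right, Nat.one_mul]
    exact max_le_max_left c ih
  | bin o ho a b iha ihb => exact (add_le_add iha ihb).trans_eq (Nat.add_mul _ _ _).symm

end Expr

namespace Cmd

/-- The number of bits in which all intermediate values of the expressions of a command fit when
the variables and the memory cells hold `c`-bit words. -/
def bits (c : ℕ) : Cmd V → ℕ
  | assign _ e => e.bits c
  | store a e => max (a.bits c) (e.bits c)
  | seq a b => max (a.bits c) (b.bits c)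
  | .loop e b => max (e.bits c) (b.bits c)

theorem bits_le {c : ℕ} (hc : 1 ≤ c) (b : Cmd V) : b.bits c ≤ b.bits 1 * c := by
  induction b with
  | assign _ e => exact e.bits_le hc
  | store a e =>
    exact (max_le_max (a.bits_le hc) (e.bits_le hc)).trans_eq (Nat.mul_max_mul_right _ _ _)
  | seq a b iha ihb => exact (max_le_max iha ihb).trans_eq (Nat.mul_max_mul_right _ _ _)
  | loop e b ih => exact (max_le_max (e.bits_le hc) ih).trans_eq (Nat.mul_max_mul_right _ _ _)

/-- `b.Exec c t σ σ'`: in a store `σ`, the command `b` ends after `t` instructions in the store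
`σ'`, all values that it assigns on the way being `c`-bit words. -/
inductive Exec [DecidableEq V] (c : ℕ) : Cmd V → ℕ → Store V → Store V → Prop
  | assign {σ : Store V} {x : V} {e : Expr V} (h : e.eval σ < 2 ^ c) :
      Exec c (.assign x e) (e.len + 1) σ (σ.set x (e.eval σ))
  | store {σ : Store V} {a e : Expr V} (h : e.eval σ < 2 ^ c) :
      Exec c (.store a e) (a.len + e.len + 1) σ (σ.write (a.eval σ) (e.eval σ))
  | seq {a b : Cmd V} {s t : ℕ} {σ σ' σ'' : Store V} (ha : Exec c a s σ σ')
      (hb : Exec c b t σ' σ'') : Exec c (.seq a b) (s + t) σ σ''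
  | exit {σ : Store V} {e : Expr V} {b : Cmd V} (h : e.eval σ = 0) :
      Exec c (.loop e b) (e.len + 1) σ σ
  | iterate {e : Expr V} {b : Cmd V} {s t : ℕ} {σ σ' σ'' : Store V} (h : e.eval σ ≠ 0)
      (hb : Exec c b s σ σ') (hw : Exec c (.loop e b) t σ' σ'') :
      Exec c (.loop e b) (e.len + 1 + s + 1 + t) σ σ''

theorem Exec.bounded [DecidableEq V] {c : ℕ} {b : Cmd V} {t : ℕ} {σ σ' : Store V}
    (h : b.Exec c t σ σ') (hσ : σ.Bounded c) : σ'.Bounded c := by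
  induction h with
  | assign h => exact hσ.set _ h
  | store h => exact hσ.write _ h
  | seq _ _ iha ihb => exact ihb (iha hσ)
  | exit _ => exact hσ
  | iterate _ _ _ ihb ihw => exact ihw (ihb hσ)

end Cmd

end WhileLanguage

/-! ## Compilation of the while language -/

section Compilation

variable {V : Type*} [Encodable V]

/-- The register of a variable. Only even registers occur in compiled commands, which leaves the
odd ones to another program. -/
def varReg (x : V) : ℕ := 4 * Encodable.encode x

/-- The `t`-th register for intermediate values of expressions. -/
def tmpReg (t : ℕ) : ℕ := 4 * t + 2

theorem varReg_ne_tmpReg (x : V) (t : ℕ) : varReg x ≠ tmpReg t := by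
  unfold varReg tmpReg
  omega

theorem varReg_injective : Function.Injective (varReg : V → ℕ) := fun _ _ h =>
  Encodable.encode_injective (Nat.eq_of_mul_eq_mul_left four_pos h)

theorem tmpReg_injective : Function.Injective tmpReg := fun s t h => by
  unfold tmpReg at h
  omega

/-- Instructions that leave the value of the expression in `tmpReg t`, using only temporary
registers from this one on. -/
def Expr.compile : ℕ → Expr V → List Instr
  | t, lit n => [.const (tmpReg t) n]
  | t, var x => [.binop .or (tmpReg t) (varReg x) (varReg x)]
  | t, load e => e.compile t ++ [.load (tmpReg t) (tmpReg t)]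
  | t, bin o _ a b =>
    a.compile t ++ (b.compile (t + 1) ++ [.binop o (tmpReg t) (tmpReg t) (tmpReg (t + 1))])

/-- The number of instructions of a compiled command. -/
def Cmd.len : Cmd V → ℕ
  | assign _ e => e.len + 1
  | store a e => a.len + e.len + 1
  | seq a b => a.len + b.len
  | .loop e b => e.len + 1 + b.len + 1

/-- Instructions that perform the command when they stand from instruction number `o` on. -/
def Cmd.compile : ℕ → Cmd V → List Instr
  | _, assign x e => e.compile 0 ++ [.binop .or (varReg x) (tmpReg 0) (tmpReg 0)]
  | _, store a e => a.compile 0 ++ (e.compile 1 ++ [.store (tmpReg 0) (tmpReg 1)])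
  | o, seq a b => a.compile o ++ b.compile (o + a.len)
  | o, .loop e b => e.compile 0 ++ (.jumpZero (tmpReg 0) (o + (e.len + 1 + b.len + 1)) ::
      (b.compile (o + (e.len + 1)) ++ [.jump o]))

theorem Expr.length_compile (e : Expr V) (t : ℕ) : (e.compile t).length = e.len := by
  induction e generalizing t with
  | lit n => rfl
  | var x => rfl
  | load e ih => simp [compile, len, ih]
  | bin o _ a b iha ihb => simp [compile, len, iha, ihb, Nat.add_assoc]

theorem Cmd.length_compile (b : Cmd V) (o : ℕ) : (b.compile o).length = b.len := by
  induction b generalizing o with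
  | assign x e => simp [compile, len, Expr.length_compile]
  | store a e => simp [compile, len, Expr.length_compile, Nat.add_assoc]
  | seq a b iha ihb => simp [compile, len, iha, ihb]
  | loop e b ih => simp [compile, len, ih, Expr.length_compile]; omega

/-- The registers `r` hold the values of the variables. -/
def Store.HeldBy (σ : Store V) (r : ℕ → ℕ) : Prop := ∀ x, r (varReg x) = σ.var x

theorem Store.HeldBy.congr {σ : Store V} {r r' : ℕ → ℕ} (h : σ.HeldBy r)
    (hr : ∀ d, (∀ u, d ≠ tmpReg u) → r' d = r d) : σ.HeldBy r' := fun x =>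
  (hr _ (varReg_ne_tmpReg x)).trans (h x)

theorem Store.HeldBy.set [DecidableEq V] {σ : Store V} {r : ℕ → ℕ} (h : σ.HeldBy r) (x : V)
    (v : ℕ) : (σ.set x v).HeldBy (Function.update r (varReg x) v) := fun y => by
  by_cases hy : y = x
  · simp [Store.set, hy]
  · simp [Store.set, hy, varReg_injective.ne hy, h y]

theorem odd_ne_varReg (d : ℕ) (x : V) : 2 * d + 1 ≠ varReg x := by
  unfold varReg
  omega

theorem odd_ne_tmpReg (d t : ℕ) : 2 * d + 1 ≠ tmpReg t := by
  unfold tmpReg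
  omega

variable {P : Program} {w c o : ℕ} {r : ℕ → ℕ} {σ : Store V}

theorem Expr.leads_compile (e : Expr V) (t : ℕ) (hP : CodeAt P o (e.compile t))
    (hw : e.bits c ≤ w) (hσ : σ.Bounded c) (hr : σ.HeldBy r) :
    ∃ r', r' (tmpReg t) = e.eval σ ∧ (∀ d, (∀ u ≥ t, d ≠ tmpReg u) → r' d = r d) ∧
      Leads P w e.len ⟨o, r, σ.mem⟩ ⟨o + e.len, r', σ.mem⟩ := by
  have hlt (e : Expr V) (he : e.bits c ≤ w) : e.eval σ < 2 ^ w :=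
    (e.eval_lt hσ).trans_le (Nat.pow_le_pow_right two_pos he)
  induction e generalizing t o r with
  | lit n =>
    exact ⟨Function.update r (tmpReg t) n, by simp [eval], fun d hd => by simp [hd t le_rfl],
      Leads.step hP.head (if_pos (hlt _ hw))⟩
  | var x =>
    refine ⟨Function.update r (tmpReg t) (σ.var x), by simp [eval],
      fun d hd => by simp [hd t le_rfl], Leads.step hP.head ?_⟩
    simp only [Instr.exec, BinOp.eval, hr x, Nat.or_self]
    exact if_pos (hlt _ hw)
  | load e ih =>
    have he : e.bits c ≤ w := (le_max_right _ _).trans hw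
    obtain ⟨r', ht, hr', hl⟩ := ih t hP.left he hr
    refine ⟨Function.update r' (tmpReg t) (σ.mem (e.eval σ)), by simp [eval],
      fun d hd => by simp [hd t le_rfl, hr' d hd],
        hl.trans (Leads.step (i := .load (tmpReg t) (tmpReg t)) ?_ ?_)⟩
    · simpa only [Expr.length_compile] using hP.right.head
    · simp only [Instr.exec, ht]
      exact if_pos (hlt _ hw)
  | bin op hop a b iha ihb =>
    have ha : a.bits c ≤ w := (Nat.le_add_right _ _).trans hw
    have hb : b.bits c ≤ w := (Nat.le_add_left _ _).trans hw
    have hPb := hP.right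
    rw [Expr.length_compile] at hPb
    obtain ⟨r₁, ht₁, hr₁, hl₁⟩ := iha t hP.left ha hr
    obtain ⟨r₂, ht₂, hr₂, hl₂⟩ := ihb (t + 1) hPb.left hb
      (hr.congr fun d hd => hr₁ d fun u _ => hd u)
    have hta : r₂ (tmpReg t) = a.eval σ :=
      (hr₂ _ fun u hu => tmpReg_injective.ne (by omega)).trans ht₁
    refine ⟨Function.update r₂ (tmpReg t) (op.eval (a.eval σ) (b.eval σ)), by simp [eval],
      fun d hd => ?_, (hl₁.trans hl₂).trans (Leads.step
        (i := .binop op (tmpReg t) (tmpReg t) (tmpReg (t + 1))) ?_ ?_)⟩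
    · simp [hd t le_rfl, hr₁ d hd, hr₂ d fun u hu => hd u (by omega)]
    · simpa only [Expr.length_compile, Nat.add_assoc] using hPb.right.head
    · simp only [Instr.exec, hta, ht₂]
      exact (if_pos (hlt _ hw)).trans (by simp only [len, Nat.add_assoc])

theorem Cmd.leads_compile_assign [DecidableEq V] {x : V} {e : Expr V}
    (hP : CodeAt P o ((Cmd.assign x e).compile o)) (hw : e.bits c ≤ w) (hσ : σ.Bounded c)
    (hr : σ.HeldBy r) :
    ∃ r', (σ.set x (e.eval σ)).HeldBy r' ∧ (∀ d, r' (2 * d + 1) = r (2 * d + 1)) ∧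
      Leads P w (e.len + 1) ⟨o, r, σ.mem⟩ ⟨o + (e.len + 1), r', σ.mem⟩ := by
  obtain ⟨r', ht, hr', hl⟩ := e.leads_compile 0 hP.left hw hσ hr
  refine ⟨Function.update r' (varReg x) (e.eval σ),
    (hr.congr fun d hd => hr' d fun u _ => hd u).set x _, fun d => ?_,
    hl.trans (Leads.step (i := .binop .or (varReg x) (tmpReg 0) (tmpReg 0)) ?_ ?_)⟩
  · rw [Function.update_of_ne (odd_ne_varReg d x), hr' _ fun u _ => odd_ne_tmpReg d u]
  · simpa only [Expr.length_compile] using hP.right.head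
  · simp only [Instr.exec, BinOp.eval, ht, Nat.or_self]
    exact if_pos ((e.eval_lt hσ).trans_le (Nat.pow_le_pow_right two_pos hw))

theorem Cmd.leads_compile_store {a e : Expr V} (hP : CodeAt P o ((Cmd.store a e).compile o))
    (ha : a.bits c ≤ w) (he : e.bits c ≤ w) (hσ : σ.Bounded c) (hr : σ.HeldBy r) :
    ∃ r', σ.HeldBy r' ∧ (∀ d, r' (2 * d + 1) = r (2 * d + 1)) ∧
      Leads P w (a.len + e.len + 1) ⟨o, r, σ.mem⟩
        ⟨o + (a.len + e.len + 1), r', Function.update σ.mem (a.eval σ) (e.eval σ)⟩ := by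
  have hPe := hP.right
  rw [Expr.length_compile] at hPe
  obtain ⟨r₁, ht₁, hr₁, hl₁⟩ := a.leads_compile 0 hP.left ha hσ hr
  have hr₁' : σ.HeldBy r₁ := hr.congr fun d hd => hr₁ d fun u _ => hd u
  obtain ⟨r₂, ht₂, hr₂, hl₂⟩ := e.leads_compile 1 hPe.left he hσ hr₁'
  have ha : r₂ (tmpReg 0) = a.eval σ :=
    (hr₂ _ fun u hu => tmpReg_injective.ne (by omega)).trans ht₁
  refine ⟨r₂, hr₁'.congr fun d hd => hr₂ d fun u _ => hd u, fun d => ?_,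
    (hl₁.trans hl₂).trans (Leads.step (i := .store (tmpReg 0) (tmpReg 1)) ?_ ?_)⟩
  · rw [hr₂ _ fun u _ => odd_ne_tmpReg d u, hr₁ _ fun u _ => odd_ne_tmpReg d u]
  · simpa only [Expr.length_compile, Nat.add_assoc] using hPe.right.head
  · simp only [Instr.exec, ha, ht₂, Nat.add_assoc]

theorem Cmd.leads_compile_test {e : Expr V} {b : Cmd V}
    (hP : CodeAt P o ((Cmd.loop e b).compile o)) (hw : e.bits c ≤ w) (hσ : σ.Bounded c)
    (hr : σ.HeldBy r) :
    ∃ r', σ.HeldBy r' ∧ (∀ d, r' (2 * d + 1) = r (2 * d + 1)) ∧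
      Leads P w (e.len + 1) ⟨o, r, σ.mem⟩
        ⟨o + if e.eval σ = 0 then (Cmd.loop e b).len else e.len + 1, r', σ.mem⟩ := by
  obtain ⟨r', ht, hr', hl⟩ := e.leads_compile 0 hP.left hw hσ hr
  refine ⟨r', hr.congr fun d hd => hr' d fun u _ => hd u,
    fun d => hr' _ fun u _ => odd_ne_tmpReg d u, hl.trans (Leads.step
      (i := .jumpZero (tmpReg 0) (o + (e.len + 1 + b.len + 1))) ?_ ?_)⟩
  · simpa only [Expr.length_compile] using hP.right.head
  · simp only [Instr.exec, ht, Cmd.len, Nat.add_assoc]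
    split <;> rfl

theorem Cmd.leads_compile [DecidableEq V] {b : Cmd V} {t : ℕ} {σ' : Store V}
    (h : b.Exec c t σ σ') (hP : CodeAt P o (b.compile o)) (hw : b.bits c ≤ w)
    (hσ : σ.Bounded c) (hr : σ.HeldBy r) :
    ∃ r', σ'.HeldBy r' ∧ (∀ d, r' (2 * d + 1) = r (2 * d + 1)) ∧
      Leads P w t ⟨o, r, σ.mem⟩ ⟨o + b.len, r', σ'.mem⟩ := by
  induction h generalizing o r with
  | assign _ => exact leads_compile_assign hP hw hσ hr
  | store _ =>
    exact leads_compile_store hP ((le_max_left _ _).trans hw) ((le_max_right _ _).trans hw) hσ hr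
  | seq ha _ iha ihb =>
    have hPb := hP.right
    rw [Cmd.length_compile] at hPb
    obtain ⟨r₁, hr₁, hodd₁, hl₁⟩ := iha hP.left ((le_max_left _ _).trans hw) hσ hr
    obtain ⟨r₂, hr₂, hodd₂, hl₂⟩ := ihb hPb ((le_max_right _ _).trans hw) (ha.bounded hσ) hr₁
    exact ⟨r₂, hr₂, fun d => (hodd₂ d).trans (hodd₁ d),
      by simpa only [Cmd.len, Nat.add_assoc] using hl₁.trans hl₂⟩
  | exit h =>
    obtain ⟨r', hr', hodd, hl⟩ := leads_compile_test hP ((le_max_left _ _).trans hw) hσ hr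
    rw [if_pos h] at hl
    exact ⟨r', hr', hodd, hl⟩
  | @iterate e b _ _ _ _ _ h hb _ ihb ihl =>
    obtain ⟨r₁, hr₁, hodd₁, hl₁⟩ := leads_compile_test hP ((le_max_left _ _).trans hw) hσ hr
    rw [if_neg h] at hl₁
    have hPb : CodeAt P (o + (e.len + 1)) (b.compile (o + (e.len + 1)) ++ [.jump o]) := by
      simpa only [Expr.length_compile, Nat.add_assoc] using hP.right.tail
    obtain ⟨r₂, hr₂, hodd₂, hl₂⟩ := ihb hPb.left ((le_max_right _ _).trans hw) hσ hr₁
    obtain ⟨r₃, hr₃, hodd₃, hl₃⟩ := ihl hP hw (hb.bounded hσ) hr₂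
    refine ⟨r₃, hr₃, fun d => ((hodd₃ d).trans (hodd₂ d)).trans (hodd₁ d),
      ((hl₁.trans hl₂).trans (Leads.step (i := .jump o) ?_ rfl)).trans hl₃⟩
    simpa only [Cmd.length_compile] using hPb.right.head

end Compilation

/-! ## Total correctness -/

namespace Cmd

variable {V : Type*} [DecidableEq V] {c s t N : ℕ} {σ : Store V} {Q R : Store V → Prop}
  {x : V} {a e : Expr V} {b b' : Cmd V}

/-- In the store `σ`, the command ends within `t` instructions in a store satisfying `Q`, and it
only assigns `c`-bit words. -/
def Ends (c : ℕ) (b : Cmd V) (t : ℕ) (σ : Store V) (Q : Store V → Prop) : Prop :=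
  ∃ t' ≤ t, ∃ σ', b.Exec c t' σ σ' ∧ Q σ'

theorem Ends.mono (h : b.Ends c s σ R) (hst : s ≤ t) (hRQ : ∀ σ', R σ' → Q σ') :
    b.Ends c t σ Q := by
  obtain ⟨t', ht', σ', hb, hσ'⟩ := h
  exact ⟨t', ht'.trans hst, σ', hb, hRQ σ' hσ'⟩

theorem ends_assign (he : e.eval σ < 2 ^ c) (hQ : Q (σ.set x (e.eval σ))) :
    (assign x e).Ends c (e.len + 1) σ Q :=
  ⟨_, le_rfl, _, .assign he, hQ⟩

theorem ends_store (he : e.eval σ < 2 ^ c) (hQ : Q (σ.write (a.eval σ) (e.eval σ))) :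
    (store a e).Ends c (a.len + e.len + 1) σ Q :=
  ⟨_, le_rfl, _, .store he, hQ⟩

theorem Ends.seq (hb : b.Ends c s σ R) (hb' : ∀ σ', R σ' → b'.Ends c t σ' Q) :
    (seq b b').Ends c (s + t) σ Q := by
  obtain ⟨s', hs', σ', hexec, hσ'⟩ := hb
  obtain ⟨t', ht', σ'', hexec', hσ''⟩ := hb' σ' hσ'
  exact ⟨s' + t', add_le_add hs' ht', σ'', hexec.seq hexec', hσ''⟩

theorem ends_loop {I : ℕ → Store V → Prop} (h0 : I 0 σ)
    (hN : ∀ τ, I N τ → e.eval τ = 0)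
    (hstep : ∀ j < N, ∀ τ, I j τ → e.eval τ ≠ 0 ∧ b.Ends c t τ (I (j + 1))) :
    (loop e b).Ends c (N * (e.len + t + 2) + e.len + 1) σ (I N) := by
  induction N generalizing σ I with
  | zero => exact ⟨e.len + 1, by omega, σ, .exit (hN σ h0), h0⟩
  | succ N ih =>
    obtain ⟨he, s, hs, σ', hb, hσ'⟩ := hstep 0 N.succ_pos σ h0
    obtain ⟨s', hs', σ'', hl, hσ''⟩ := ih (I := fun j => I (j + 1)) hσ' hN
      fun j hj => hstep (j + 1) (by omega)
    refine ⟨_, ?_, σ'', .iterate he hb hl, hσ''⟩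
    rw [Nat.succ_mul]
    omega

/-- For each `i < e` perform `b`; the bound `e` is evaluated anew in each round. -/
def forRange (i : V) (e : Expr V) (b : Cmd V) : Cmd V :=
  seq (assign i (.lit 0))
    (loop (.bin .sub nofun e (.var i)) (seq b (assign i (.bin .add nofun (.var i) (.lit 1)))))

theorem ends_forRange {i : V} {I : ℕ → Store V → Prop} (hN : N < 2 ^ c) (h0 : I 0 (σ.set i 0))
    (he : ∀ j τ, I j τ → e.eval τ = N)
    (hstep : ∀ j < N, ∀ τ, τ.var i = j → I j τ →
      b.Ends c t τ fun τ' => τ'.var i = j ∧ I (j + 1) (τ'.set i (j + 1))) :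
    (forRange i e b).Ends c (N * (e.len + t + 8) + e.len + 5) σ (I N) := by
  have hloop : ∀ τ, τ.var i = 0 ∧ I 0 τ → (loop (.bin .sub nofun e (.var i))
      (seq b (assign i (.bin .add nofun (.var i) (.lit 1))))).Ends c
      (N * (e.len + t + 8) + e.len + 3) τ (I N) := fun τ hτ => by
    refine (ends_loop (t := t + 4) (N := N) (I := fun j τ => τ.var i = j ∧ I j τ) hτ
      (fun τ hτ => ?_) fun j hj τ hτ => ⟨?_, ?_⟩).mono ?_ fun τ hτ => hτ.2
    · simp [Expr.eval, BinOp.eval, he N τ hτ.2, hτ.1]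
    · simp only [Expr.eval, BinOp.eval, he j τ hτ.2, hτ.1]
      omega
    · refine (hstep j hj τ hτ.1 hτ.2).seq fun τ' hτ' => ends_assign ?_ ?_
      · simp only [Expr.eval, BinOp.eval, hτ'.1]
        omega
      · simpa [Expr.eval, BinOp.eval, hτ'.1, Store.set] using hτ'.2
    · simp only [Expr.len]
      refine le_of_eq ?_
      ring
  have hinit : (assign i (.lit 0)).Ends c 2 σ fun τ => τ.var i = 0 ∧ I 0 τ :=
    ends_assign (by simp [Expr.eval]) ⟨by simp [Store.set, Expr.eval], h0⟩
  exact (hinit.seq hloop).mono (by omega) fun _ h => h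

end Cmd

/-! ## Running another program inside a shifted memory -/

/-- The register that simulates register `d`. -/
def guestReg (d : ℕ) : ℕ := 2 * d + 1

theorem guestReg_injective : Function.Injective guestReg := fun d e h => by
  unfold guestReg at h
  omega

theorem guestReg_ne_of_even {d e : ℕ} (he : Even e) : guestReg d ≠ e := by
  rintro rfl
  exact Nat.not_even_bit1 d he

/-- Two instructions simulating one: memory is shifted by the content of register `b`, simulated
instruction `l` stands at `o + 2 * l`, and register `a₀` is used for addresses and for padding. -/
def Instr.shift (o b a₀ : ℕ) : Instr → List Instr
  | .const d v => [.const (guestReg d) v, .const a₀ 0]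
  | .binop x d a c => [.binop x (guestReg d) (guestReg a) (guestReg c), .const a₀ 0]
  | .load d a => [.binop .add a₀ b (guestReg a), .load (guestReg d) a₀]
  | .store a c => [.binop .add a₀ b (guestReg a), .store a₀ (guestReg c)]
  | .jump l => [.jump (o + 2 * l), .reject]
  | .jumpZero a l => [.jumpZero (guestReg a) (o + 2 * l), .const a₀ 0]
  | .accept => [.accept, .reject]
  | .reject => [.reject, .reject]

/-- The simulation of a program inside a shifted memory. -/
def Program.shift (o b a₀ : ℕ) (P : Program) : Program :=
  P.flatMap (Instr.shift o b a₀)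

theorem Instr.length_shift (o b a₀ : ℕ) (i : Instr) : (i.shift o b a₀).length = 2 := by
  cases i <;> rfl

theorem CodeAt.shift {P P' : Program} {o b a₀ n : ℕ} {i : Instr}
    (h : CodeAt P' o (P.shift o b a₀)) (hi : P[n]? = some i) :
    CodeAt P' (o + 2 * n) (i.shift o b a₀) := by
  obtain ⟨hn, rfl⟩ := List.getElem?_eq_some_iff.1 hi
  have hlen : ((P.take n).flatMap (Instr.shift o b a₀)).length = 2 * n := by
    simp [List.length_flatMap, Instr.length_shift, hn.le, Nat.mul_comm]
  rw [Program.shift, ← List.take_append_drop n P, List.drop_eq_getElem_cons hn,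
    List.flatMap_append, List.flatMap_cons] at h
  simpa only [hlen] using h.right.left

/-- The registers and the memory of `s'` represent those of `s`, which has `w`-bit words; memory is
shifted by `β`, to be found in register `b`. -/
structure Represents (b β w : ℕ) (s s' : State) : Prop where
  reg (d : ℕ) : s'.reg (guestReg d) = s.reg d
  base : s'.reg b = β
  mem (a : ℕ) : s'.mem (β + a) = s.mem a
  reg_lt (d : ℕ) : s.reg d < 2 ^ w

namespace Represents

variable {P P' : Program} {o b a₀ a β w w' l d v : ℕ} {s s' t : State} {i j : Instr}

theorem setPC (h : Represents b β w s s') (l l' : ℕ) :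
    Represents b β w ⟨l, s.reg, s.mem⟩ ⟨l', s'.reg, s'.mem⟩ :=
  ⟨h.reg, h.base, h.mem, h.reg_lt⟩

theorem setReg (h : Represents b β w s s') (hb : Even b) (d : ℕ) (hv : v < 2 ^ w) (l l' : ℕ) :
    Represents b β w ⟨l, Function.update s.reg d v, s.mem⟩
      ⟨l', Function.update s'.reg (guestReg d) v, s'.mem⟩ where
  reg e := by
    by_cases hd : e = d
    · simp [hd]
    · simp [hd, guestReg_injective.ne hd, h.reg]
  base := by simp [(guestReg_ne_of_even hb).symm, h.base]
  mem := h.mem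
  reg_lt e := by
    by_cases hd : e = d
    · simpa [hd] using hv
    · simpa [hd] using h.reg_lt e

theorem setAddress (h : Represents b β w s s') (ha₀ : Even a₀) (hab : a₀ ≠ b) (v l' : ℕ) :
    Represents b β w s ⟨l', Function.update s'.reg a₀ v, s'.mem⟩ where
  reg e := by simp [guestReg_ne_of_even ha₀, h.reg]
  base := by simp [hab.symm, h.base]
  mem := h.mem
  reg_lt := h.reg_lt

theorem write (h : Represents b β w s s') (a v l l' : ℕ) :
    Represents b β w ⟨l, s.reg, Function.update s.mem a v⟩
      ⟨l', s'.reg, Function.update s'.mem (β + a) v⟩ where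
  reg := h.reg
  base := h.base
  mem e := by
    by_cases he : e = a
    · simp [he]
    · simp [he, h.mem]
  reg_lt := h.reg_lt

theorem leads_pad (h : Represents b β w t s') (ha₀ : Even a₀) (hab : a₀ ≠ b)
    (hP : P'[s'.pc]? = some (.const a₀ 0)) :
    ∃ t', t'.pc = s'.pc + 1 ∧ Represents b β w t t' ∧ Leads P' w' 1 s' t' :=
  ⟨_, rfl, h.setAddress ha₀ hab 0 _, Leads.step hP (if_pos (by positivity))⟩

theorem leads_address (h : Represents b β w s s') (hw : β + 2 ^ w ≤ 2 ^ w')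
    (hP : P'[s'.pc]? = some (.binop .add a₀ b (guestReg a))) :
    Leads P' w' 1 s' ⟨s'.pc + 1, Function.update s'.reg a₀ (β + s.reg a), s'.mem⟩ := by
  refine Leads.step hP ?_
  simp only [Instr.exec, h.reg, h.base, BinOp.eval]
  exact if_pos (by have := h.reg_lt a; omega)

theorem step_setReg (h : Represents b β w s s') (hb : Even b) (ha₀ : Even a₀) (hab : a₀ ≠ b)
    (hw : 2 ^ w ≤ 2 ^ w') (hpc : s'.pc = o + 2 * s.pc) (hP : CodeAt P' s'.pc [j, .const a₀ 0])
    (hj : j.exec w' s' = s'.setReg w' (guestReg d) v) (ht : s.setReg w d v = some t) :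
    ∃ t', t'.pc = o + 2 * t.pc ∧ Represents b β w t t' ∧ Leads P' w' 2 s' t' := by
  obtain ⟨hv, rfl⟩ : v < 2 ^ w ∧ _ := by simpa [State.setReg] using ht
  obtain ⟨t', hpc', ht', hl⟩ := (h.setReg hb d hv (s.pc + 1) (s'.pc + 1)).leads_pad
    (P' := P') (w' := w') ha₀ hab hP.tail.head
  refine ⟨t', ?_, ht', (Leads.step hP.head (hj.trans (if_pos (hv.trans_le hw)))).trans hl⟩
  rw [hpc', hpc, Nat.mul_succ, Nat.add_assoc]
  rfl

theorem step_load {c : ℕ} (h : Represents b β w s s') (hb : Even b) (ha₀ : Even a₀) (hab : a₀ ≠ b)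
    (hw : β + 2 ^ w ≤ 2 ^ w') (hpc : s'.pc = o + 2 * s.pc)
    (hP : CodeAt P' s'.pc [.binop .add a₀ b (guestReg c), .load (guestReg d) a₀])
    (ht : (Instr.load d c).exec w s = some t) :
    ∃ t', t'.pc = o + 2 * t.pc ∧ Represents b β w t t' ∧ Leads P' w' 2 s' t' := by
  obtain ⟨hv, rfl⟩ : s.mem (s.reg c) < 2 ^ w ∧ _ := by simpa [Instr.exec, State.setReg] using ht
  refine ⟨_, ?_,
    (h.setAddress ha₀ hab (β + s.reg c) (s'.pc + 1)).setReg hb d hv (s.pc + 1) (s'.pc + 2),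
    (h.leads_address hw hP.head).trans (Leads.step hP.tail.head ?_)⟩
  · rw [hpc, Nat.mul_succ, Nat.add_assoc]
  · simp only [Instr.exec, Function.update_self, h.mem]
    exact if_pos (by omega)

theorem step_store {c : ℕ} (h : Represents b β w s s') (ha₀ : Even a₀) (hab : a₀ ≠ b)
    (hw : β + 2 ^ w ≤ 2 ^ w') (hpc : s'.pc = o + 2 * s.pc)
    (hP : CodeAt P' s'.pc [.binop .add a₀ b (guestReg a), .store a₀ (guestReg c)])
    (ht : (Instr.store a c).exec w s = some t) :
    ∃ t', t'.pc = o + 2 * t.pc ∧ Represents b β w t t' ∧ Leads P' w' 2 s' t' := by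
  cases ht
  refine ⟨_, ?_, (h.setAddress ha₀ hab (β + s.reg a) (s'.pc + 1)).write (s.reg a) (s.reg c)
    (s.pc + 1) (s'.pc + 2), (h.leads_address hw hP.head).trans (Leads.step hP.tail.head ?_)⟩
  · rw [hpc, Nat.mul_succ, Nat.add_assoc]
  · simp [Instr.exec, guestReg_ne_of_even ha₀, h.reg]

theorem step_jumpZero (h : Represents b β w s s') (ha₀ : Even a₀) (hab : a₀ ≠ b)
    (hpc : s'.pc = o + 2 * s.pc)
    (hP : CodeAt P' s'.pc [.jumpZero (guestReg a) (o + 2 * l), .const a₀ 0])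
    (ht : (Instr.jumpZero a l).exec w s = some t) :
    ∃ n ≤ 2, ∃ t', t'.pc = o + 2 * t.pc ∧ Represents b β w t t' ∧ Leads P' w' n s' t' := by
  cases ht
  by_cases hz : s.reg a = 0
  · refine ⟨1, one_le_two, _, ?_, h.setPC _ (o + 2 * l), Leads.step hP.head ?_⟩
    · simp [hz]
    · simp [Instr.exec, h.reg, hz]
  · obtain ⟨t', hpc', ht', hl⟩ := (h.setPC (s.pc + 1) (s'.pc + 1)).leads_pad (P' := P') (w' := w')
      ha₀ hab hP.tail.head
    refine ⟨2, le_rfl, t', ?_, by simpa [hz] using ht', (Leads.step hP.head ?_).trans hl⟩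
    · simp [hz, hpc', hpc, Nat.mul_succ, Nat.add_assoc]
    · simp [Instr.exec, h.reg, hz]

theorem step (h : Represents b β w s s') (hb : Even b) (ha₀ : Even a₀) (hab : a₀ ≠ b)
    (hw : β + 2 ^ w ≤ 2 ^ w') (hpc : s'.pc = o + 2 * s.pc)
    (hP : CodeAt P' s'.pc (i.shift o b a₀)) (ht : i.exec w s = some t) :
    ∃ n ≤ 2, ∃ t', t'.pc = o + 2 * t.pc ∧ Represents b β w t t' ∧ Leads P' w' n s' t' := by
  have hww' : 2 ^ w ≤ 2 ^ w' := by omega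
  cases i with
  | const d v => exact ⟨2, le_rfl, h.step_setReg hb ha₀ hab hww' hpc hP rfl ht⟩
  | binop x d a c =>
    refine ⟨2, le_rfl, h.step_setReg hb ha₀ hab hww' hpc hP ?_ ht⟩
    rw [Instr.exec, h.reg, h.reg]
  | load d a => exact ⟨2, le_rfl, h.step_load hb ha₀ hab hw hpc hP ht⟩
  | store a c => exact ⟨2, le_rfl, h.step_store ha₀ hab hw hpc hP ht⟩
  | jump l =>
    cases ht
    exact ⟨1, one_le_two, _, rfl, h.setPC _ (o + 2 * l), Leads.step hP.head rfl⟩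
  | jumpZero a l => exact h.step_jumpZero ha₀ hab hpc hP ht
  | accept => cases ht
  | reject => cases ht

theorem run (h : Represents b β w s s') (hb : Even b) (ha₀ : Even a₀) (hab : a₀ ≠ b)
    (hw : β + 2 ^ w ≤ 2 ^ w') (hP : CodeAt P' o (P.shift o b a₀)) (hpc : s'.pc = o + 2 * s.pc)
    {n : ℕ} {x : Bool} (hr : WordRAM.run P w n s = some x) :
    WordRAM.run P' w' (2 * n) s' = some x := by
  induction n generalizing s s' with
  | zero => simp [WordRAM.run] at hr
  | succ n ih =>
    rw [WordRAM.run] at hr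
    have hcode {i : Instr} (hi : P[s.pc]? = some i) : CodeAt P' s'.pc (i.shift o b a₀) :=
      hpc ▸ hP.shift hi
    split at hr
    · simp at hr
    · rename_i hi
      rw [Nat.mul_succ, WordRAM.run, (hcode hi).head]
      exact hr
    · rename_i hi
      rw [Nat.mul_succ, WordRAM.run, (hcode hi).head]
      exact hr
    · rename_i hi
      obtain ⟨t, ht, hr⟩ := Option.bind_eq_some_iff.1 hr
      obtain ⟨k, hk, t', hpc', ht', hl⟩ := h.step hb ha₀ hab hw hpc (hcode hi) ht
      exact run_mono (by omega) ((hl _).trans (ih ht' hpc' hr))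

end Represents

end WordRAM

/-! ## Two-digit numbers -/

theorem mul_add_lt_mul_of_lt {a b R u : ℕ} (ha : a < b) (hu : u < R) : a * R + u < b * R := by
  nlinarith

theorem mul_add_div_eq_of_lt {a R u : ℕ} (hu : u < R) : (a * R + u) / R = a := by
  rw [Nat.mul_comm, Nat.mul_add_div (by omega), Nat.div_eq_of_lt hu, Nat.add_zero]

theorem mul_add_eq_mul_add_iff {a b R u v : ℕ} (hu : u < R) (hv : v < R) :
    a * R + u = b * R + v ↔ a = b ∧ u = v := by
  refine ⟨fun h => ?_, fun ⟨ha, hu⟩ => by rw [ha, hu]⟩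
  have hab : a = b := by
    simpa only [mul_add_div_eq_of_lt, hu, hv] using congrArg (· / R) h
  exact ⟨hab, Nat.add_left_cancel (hab ▸ h)⟩

namespace CycleReduction

/-! ## A small family of colourings -/

/-- The bit test number `d` of `v`: bit number `d / 2`, negated for odd `d`. -/
def bitTest (d v : ℕ) : ℕ := (v >>> (d / 2) + d) % 2

theorem bitTest_eq_zero_iff (i : ℕ) (b : Bool) (v : ℕ) :
    bitTest (2 * i + b.toNat) v = 0 ↔ v.testBit i = b := by
  have hi : (2 * i + b.toNat) / 2 = i := by
    cases b
    · simp
    · simp; omega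
  rw [bitTest, hi, Nat.testBit_eq_decide_div_mod_eq, Nat.shiftRight_eq_div_pow]
  cases b
  · simp
  · simp; omega

theorem exists_testBit_ne {R u v : ℕ} (hu : u < R) (hv : v < R) (huv : u ≠ v) :
    ∃ i < R.size, u.testBit i ≠ v.testBit i := by
  obtain ⟨i, hi⟩ := Nat.exists_testBit_ne_of_ne huv
  refine ⟨i, lt_of_not_ge fun hR => hi ?_, hi⟩
  have hR' : R < 2 ^ i := Nat.size_le.1 hR
  rw [Nat.testBit_lt_two_pow (hu.trans hR'), Nat.testBit_lt_two_pow (hv.trans hR')]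

theorem exists_bitTest_eq_zero {R u v : ℕ} (hu : u < R) (hv : v < R) :
    ∃ d < 2 * R.size, bitTest d u = 0 ∧ (u ≠ v → bitTest d v ≠ 0) := by
  obtain ⟨i, hi, huv⟩ : ∃ i < R.size, u ≠ v → u.testBit i ≠ v.testBit i := by
    by_cases huv : u = v
    · exact ⟨0, Nat.size_pos.2 (by omega), fun h => (h huv).elim⟩
    · obtain ⟨i, hi, h⟩ := exists_testBit_ne hu hv huv
      exact ⟨i, hi, fun _ => h⟩
  refine ⟨2 * i + (u.testBit i).toNat, ?_, (bitTest_eq_zero_iff i _ u).2 rfl, fun h => ?_⟩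
  · have := (u.testBit i).toNat_lt
    omega
  · rw [Ne, bitTest_eq_zero_iff]
    exact (huv h).symm

/-- The `p`-th digit of `h` in base `D`. -/
def digit (D h p : ℕ) : ℕ := h / D ^ p % D

theorem exists_digit_eq {D K : ℕ} (d : ℕ → ℕ) (hd : ∀ p < K, d p < D) :
    ∃ h < D ^ K, ∀ p < K, digit D h p = d p := by
  let f : Fin K → Fin D := fun p => ⟨d p, hd p p.2⟩
  refine ⟨finFunctionFinEquiv f, (finFunctionFinEquiv f).2, fun p hp => ?_⟩
  rw [digit, ← finFunctionFinEquiv_symm_apply_val _ ⟨p, hp⟩, Equiv.symm_apply_apply]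

/-- The colouring `h` admits the vertex `v` in position `j` of a `k`-cycle. The `k * k` digits of
`h` in base `D` are bit tests, the `p`-th of which tells the vertices in the positions `p / k` and
`p % k` apart: it has to vanish in the former position, and not to vanish in the latter one. -/
def Admits (k D h j v : ℕ) : Prop :=
  ∀ p < k * k, j = p / k ∨ j = p % k → (bitTest (digit D h p) v = 0 ↔ j = p / k)

theorem Admits.ne {k D h i j u v : ℕ} (hi : i < k) (hj : j < k) (hij : i ≠ j)
    (hu : Admits k D h i u) (hv : Admits k D h j v) : u ≠ v := by
  rintro rfl
  have hp : i * k + j < k * k := mul_add_lt_mul_of_lt hi hj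
  have hdiv : (i * k + j) / k = i := mul_add_div_eq_of_lt hj
  have hmod : (i * k + j) % k = j := Nat.mul_add_mod_of_lt hj
  have hi' := (hu _ hp (.inl hdiv.symm)).2 hdiv.symm
  exact hij (hdiv.symm.trans ((hv _ hp (.inr hmod.symm)).1 hi').symm)

theorem exists_admits {k R : ℕ} (c : ℕ → ℕ) (hR : ∀ i < k, c i < R)
    (hc : Set.InjOn c (Set.Iio k)) :
    ∃ h < (2 * R.size) ^ (k * k), ∀ j < k, Admits k (2 * R.size) h j (c j) := by
  have hdiv {p : ℕ} (hp : p < k * k) : p / k < k := Nat.div_lt_of_lt_mul hp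
  have hmod {p : ℕ} (hp : p < k * k) : p % k < k :=
    Nat.mod_lt _ (Nat.pos_of_ne_zero fun hk => by simp [hk] at hp)
  choose! d hd h0 h1 using fun p (hp : p < k * k) =>
    exists_bitTest_eq_zero (hR _ (hdiv hp)) (hR _ (hmod hp))
  obtain ⟨h, hh, hdigit⟩ := exists_digit_eq d hd
  refine ⟨h, hh, fun j hj p hp hjp => ?_⟩
  rw [hdigit p hp]
  refine ⟨fun hz => ?_, fun hj => hj ▸ h0 p hp⟩
  by_contra hne
  obtain rfl : j = p % k := hjp.resolve_left hne
  exact h1 p hp (fun heq => hne (hc (hdiv hp) hj heq).symm) hz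

end CycleReduction

/-! ## Closed walks in layered graphs as runs -/

/-- A directed graph on states below `states`, of which `j * width + g` with `j ≤ depth` and
`g < width` is the state number `g` of the layer `j`. Every arc leads from a layer to the next one,
or to a state outside of all layers, a dead end: arcs that are to be deleted are redirected there,
so that their number is known in advance. -/
structure LayeredGraph where
  depth : ℕ
  width : ℕ
  states : ℕ
  arcs : List (ℕ × ℕ)
  depth_pos : 0 < depth
  one_lt_width : 1 < width
  le_states : (depth + 1) * width ≤ states
  nodup : arcs.Nodup
  fst_lt : ∀ a ∈ arcs, a.1 < depth * width
  snd_lt : ∀ a ∈ arcs, a.2 < states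
  snd_div : ∀ a ∈ arcs, a.2 < (depth + 1) * width → a.2 / width = a.1 / width + 1

namespace LayeredGraph

variable (L : LayeredGraph)

/-- `w 0, …, w j` are the positions within their layers of the states on a walk starting in the
layer `0`. -/
def IsWalk (j : ℕ) (w : ℕ → ℕ) : Prop :=
  (∀ i ≤ j, w i < L.width) ∧
    ∀ i < j, (i * L.width + w i, (i + 1) * L.width + w (i + 1)) ∈ L.arcs

/-- Some walk through all layers ends in the position where it started. -/
def HasClosedWalk : Prop := ∃ w, L.IsWalk L.depth w ∧ w 0 = w L.depth

/-- The transitions of the VASS, with updates `-1`, `0`, `1` written as `0`, `1`, `2`: the counter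
decreases along the layer `0`, stays constant along arcs, and increases when going down in the last
layer. -/
def triples : List (ℕ × ℕ × ℕ) :=
  ((List.range (L.width - 1)).flatMap fun g =>
    [(g, 0, g + 1), (L.depth * L.width + (g + 1), 2, L.depth * L.width + g)]) ++
    L.arcs.map fun a => (a.1, 1, a.2)

/-- One step between configurations with counter values at most `B`. -/
def Step (B : ℕ) (c c' : ℕ × ℕ) : Prop :=
  ∃ b, (c.1, b, c'.1) ∈ L.triples ∧ c'.2 + 1 = c.2 + b ∧ c.2 ≤ B ∧ c'.2 ≤ B

/-- The invariant of the runs from the state `0` and counter value `B`: the run has followed a walk,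
the counter has decreased by the first position of the walk, and in the last layer it has increased
by as much as the position has decreased. -/
def Inv (B s v : ℕ) : Prop :=
  (∃ j < L.depth, ∃ w, L.IsWalk j w ∧ s = j * L.width + w j ∧ v + w 0 = B) ∨
  (∃ w, L.IsWalk L.depth w ∧ ∃ g ≤ w L.depth,
    s = L.depth * L.width + g ∧ v + w 0 + g = B + w L.depth) ∨
  (L.depth + 1) * L.width ≤ s

variable {L}

theorem mem_triples {s b t : ℕ} : (s, b, t) ∈ L.triples ↔
    (s + 1 < L.width ∧ b = 0 ∧ t = s + 1) ∨
    (∃ g, g + 1 < L.width ∧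
      s = L.depth * L.width + (g + 1) ∧ b = 2 ∧ t = L.depth * L.width + g) ∨
    ((s, t) ∈ L.arcs ∧ b = 1) := by
  simp only [triples, List.mem_append, List.mem_flatMap, List.mem_range, List.mem_cons,
    List.not_mem_nil, or_false, List.mem_map, Prod.mk.injEq, Prod.exists]
  constructor
  · rintro (⟨g, hg, ⟨rfl, rfl, rfl⟩ | ⟨rfl, rfl, rfl⟩⟩ | ⟨_, _, ha, rfl, rfl, rfl⟩)
    · exact .inl ⟨by omega, rfl, rfl⟩
    · exact .inr (.inl ⟨g, by omega, rfl, rfl, rfl⟩)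
    · exact .inr (.inr ⟨ha, rfl⟩)
  · rintro (⟨hs, rfl, rfl⟩ | ⟨g, hg, rfl, rfl, rfl⟩ | ⟨ha, rfl⟩)
    · exact .inl ⟨s, by omega, .inl ⟨rfl, rfl, rfl⟩⟩
    · exact .inl ⟨g, by omega, .inr ⟨rfl, rfl, rfl⟩⟩
    · exact .inr ⟨s, t, ha, rfl, rfl, rfl⟩

theorem width_le_depth_mul : L.width ≤ L.depth * L.width := Nat.le_mul_of_pos_left _ L.depth_pos

namespace IsWalk

variable {j : ℕ} {w : ℕ → ℕ}

theorem zero {g : ℕ} (hg : g < L.width) : L.IsWalk 0 fun _ => g :=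
  ⟨fun _ _ => hg, fun _ hi => absurd hi (Nat.not_lt_zero _)⟩

theorem extend {g : ℕ} (hw : L.IsWalk j w) (hg : g < L.width)
    (ha : (j * L.width + w j, (j + 1) * L.width + g) ∈ L.arcs) :
    L.IsWalk (j + 1) (Function.update w (j + 1) g) := by
  refine ⟨fun i hi => ?_, fun i hi => ?_⟩
  · obtain rfl | hi' := hi.eq_or_lt
    · simpa using hg
    · rw [Function.update_of_ne (by omega)]
      exact hw.1 i (by omega)
  · rw [Function.update_of_ne (by omega : i ≠ j + 1)]
    obtain rfl | hij := (Nat.le_of_lt_succ hi).eq_or_lt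
    · simpa using ha
    · rw [Function.update_of_ne (by omega)]
      exact hw.2 i hij

end IsWalk

namespace Inv

variable {B s t g v : ℕ}

theorem start : L.Inv B 0 B :=
  .inl ⟨0, L.depth_pos, _, .zero (zero_lt_one.trans L.one_lt_width), by simp, rfl⟩

theorem descend (h : L.Inv B s (v + 1)) (hs : s + 1 < L.width) : L.Inv B (s + 1) v := by
  have hG := L.width_le_depth_mul
  have hG' : (L.depth + 1) * L.width = L.depth * L.width + L.width := Nat.succ_mul _ _
  obtain ⟨j, -, w, -, rfl, hv⟩ | ⟨w, -, g, -, rfl, -⟩ | h := h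
  · obtain rfl : j = 0 := by
      by_contra hj
      have : L.width ≤ j * L.width := Nat.le_mul_of_pos_left _ (Nat.pos_of_ne_zero hj)
      omega
    exact .inl ⟨0, L.depth_pos, _, .zero hs, by omega, by omega⟩
  · omega
  · omega

theorem ascend (h : L.Inv B (L.depth * L.width + (g + 1)) v) (hg : g + 1 < L.width) :
    L.Inv B (L.depth * L.width + g) (v + 1) := by
  have hG' : (L.depth + 1) * L.width = L.depth * L.width + L.width := Nat.succ_mul _ _
  obtain ⟨j, hj, w, hw, hs, -⟩ | ⟨w, hw, g', hg', hs, hv⟩ | h := h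
  · have := mul_add_lt_mul_of_lt hj (hw.1 j le_rfl)
    omega
  · exact .inr (.inl ⟨w, hw, g, by omega, rfl, by omega⟩)
  · omega

theorem arc (h : L.Inv B s v) (ha : (s, t) ∈ L.arcs) : L.Inv B t v := by
  have hG' : (L.depth + 1) * L.width = L.depth * L.width + L.width := Nat.succ_mul _ _
  have hs := L.fst_lt _ ha
  obtain ⟨j, hj, w, hw, rfl, hv⟩ | ⟨w, -, g, -, rfl, -⟩ | h := h
  · by_cases ht : t < (L.depth + 1) * L.width
    · have hdiv : t / L.width = j + 1 := by
        simpa only [mul_add_div_eq_of_lt (hw.1 j le_rfl)] using L.snd_div _ ha ht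
      obtain ⟨g, hg, rfl⟩ : ∃ g < L.width, t = (j + 1) * L.width + g :=
        ⟨t % L.width, Nat.mod_lt _ (zero_lt_one.trans L.one_lt_width), by
          rw [← hdiv, Nat.mul_comm, Nat.div_add_mod]⟩
      have hw' := hw.extend hg ha
      obtain hj' | hj' := (Nat.succ_le_of_lt hj).lt_or_eq
      · exact .inl ⟨j + 1, hj', _, hw', by simp, by simpa using hv⟩
      · rw [Nat.succ_eq_add_one] at hj'
        rw [hj'] at hw' ⊢
        exact .inr (.inl ⟨_, hw', g, by simp [← hj'], rfl, by simp [← hj', hv]⟩)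
    · exact .inr (.inr (not_lt.1 ht))
  · omega
  · omega

theorem step {c c' : ℕ × ℕ} (h : L.Inv B c.1 c.2) (hs : L.Step B c c') : L.Inv B c'.1 c'.2 := by
  obtain ⟨s, v⟩ := c
  obtain ⟨s', v'⟩ := c'
  obtain ⟨b, hb, hv, -, -⟩ := hs
  obtain ⟨hs, rfl, rfl⟩ | ⟨g, hg, rfl, rfl, rfl⟩ | ⟨ha, rfl⟩ := mem_triples.1 hb
  · obtain rfl : v = v' + 1 := hv.symm
    exact h.descend hs
  · obtain rfl : v' = v + 1 := Nat.succ_injective hv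
    exact h.ascend hg
  · obtain rfl : v' = v := Nat.succ_injective hv
    exact h.arc ha

theorem hasClosedWalk (h : L.Inv B (L.depth * L.width) B) : L.HasClosedWalk := by
  have hG := L.one_lt_width
  have hG' : (L.depth + 1) * L.width = L.depth * L.width + L.width := Nat.succ_mul _ _
  obtain ⟨j, hj, w, hw, hs, -⟩ | ⟨w, hw, g', -, hs, hv⟩ | h := h
  · exact absurd hs (mul_add_lt_mul_of_lt hj (hw.1 j le_rfl)).ne'
  · exact ⟨w, hw, by omega⟩
  · omega

end Inv

open Relation (ReflTransGen)

theorem reaches_descending {B g : ℕ} (hg : g < L.width) (hB : g ≤ B) :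
    ReflTransGen (L.Step B) (0, B) (g, B - g) := by
  induction g with
  | zero => exact .refl
  | succ g ih =>
    exact (ih (by omega) (by omega)).tail
      ⟨0, mem_triples.2 (.inl ⟨hg, rfl, rfl⟩), by simp only; omega⟩

theorem IsWalk.reaches {B v j : ℕ} {w : ℕ → ℕ} (hw : L.IsWalk j w) (hv : v ≤ B) :
    ReflTransGen (L.Step B) (w 0, v) (j * L.width + w j, v) := by
  induction j with
  | zero => simpa using .refl
  | succ j ih =>
    have hj : L.IsWalk j w := ⟨fun i hi => hw.1 i (by omega), fun i hi => hw.2 i (by omega)⟩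
    exact (ih hj).tail ⟨1, mem_triples.2 (.inr (.inr ⟨hw.2 j (by omega), rfl⟩)), rfl, hv, hv⟩

theorem reaches_ascending {B v g : ℕ} (hg : g < L.width) (hB : v + g ≤ B) :
    ReflTransGen (L.Step B) (L.depth * L.width + g, v) (L.depth * L.width, v + g) := by
  induction g generalizing v with
  | zero => exact .refl
  | succ g ih =>
    refine .head ⟨2, mem_triples.2 (.inr (.inl ⟨g, hg, rfl, rfl, rfl⟩)), rfl, ?_⟩
      ((ih (v := v + 1) (by omega) (by omega)).trans ?_)
    · simp only
      omega
    · rw [Nat.add_right_comm, Nat.add_assoc]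

theorem HasClosedWalk.reaches {B : ℕ} (h : L.HasClosedWalk) (hB : L.width ≤ B) :
    ReflTransGen (L.Step B) (0, B) (L.depth * L.width, B) := by
  obtain ⟨w, hw, hw0⟩ := h
  have h0 : w 0 < L.width := hw.1 0 (Nat.zero_le _)
  have h1 := reaches_descending h0 (by omega : w 0 ≤ B)
  have h2 := hw.reaches (Nat.sub_le B (w 0))
  have h3 := reaches_ascending (L := L) (B := B) (v := B - w 0) h0 (by omega)
  rw [hw0] at h2 h3
  rw [hw0] at h1
  simpa [Nat.sub_add_cancel (by omega : w L.depth ≤ B)] using (h1.trans h2).trans h3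

end LayeredGraph

theorem le_linearBound {γ : ℚ} (hγ : 0 < γ) {a n : ℕ} (h : γ.den * a ≤ n) :
    a ≤ linearBound γ n := by
  rw [linearBound, Nat.le_floor_iff (by positivity)]
  have hnum : (1 : ℚ) ≤ γ.num := by exact_mod_cast Rat.num_pos.2 hγ
  calc (a : ℚ) ≤ γ.num * a := le_mul_of_one_le_left (by positivity) hnum
    _ = γ * (γ.den * a) := by rw [← mul_assoc, Rat.mul_den_eq_num]
    _ ≤ γ * n := mul_le_mul_of_nonneg_left (by exact_mod_cast h) hγ.le

theorem linearBound_eq_div {γ : ℚ} (hγ : 0 < γ) (n : ℕ) :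
    linearBound γ n = γ.num.toNat * n / γ.den := by
  have hn : ((γ.num.toNat : ℕ) : ℚ) = γ.num := by
    exact_mod_cast Int.toNat_of_nonneg (Rat.num_pos.2 hγ).le
  have : γ * (n : ℚ) = ((γ.num.toNat * n : ℕ) : ℚ) / (γ.den : ℚ) := by
    rw [Nat.cast_mul, hn, mul_div_right_comm, Rat.num_div_den]
  rw [linearBound, this, Nat.floor_div_eq_div]

namespace LayeredGraph

variable (L : LayeredGraph)

theorem lt_states {s : ℕ} (hs : s < (L.depth + 1) * L.width) : s < L.states :=
  hs.trans_le L.le_states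

theorem last_lt_states : L.depth * L.width < L.states :=
  L.lt_states (Nat.mul_lt_mul_of_pos_right (Nat.lt_succ_self _) (zero_lt_one.trans L.one_lt_width))

instance : NeZero L.states := ⟨(Nat.zero_le _ |>.trans_lt L.last_lt_states).ne'⟩

variable {L} in
theorem triples_lt {s b t : ℕ} (h : (s, b, t) ∈ L.triples) :
    s < L.states ∧ b ≤ 2 ∧ t < L.states := by
  have hS := L.le_states
  have := L.width_le_depth_mul
  have hG' : (L.depth + 1) * L.width = L.depth * L.width + L.width := Nat.succ_mul _ _
  obtain ⟨hs, rfl, rfl⟩ | ⟨g, hg, rfl, rfl, rfl⟩ | ⟨ha, rfl⟩ := mem_triples.1 h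
  · omega
  · omega
  · have hs := L.fst_lt _ ha
    have ht := L.snd_lt _ ha
    simp only at hs ht
    omega

theorem nodup_triples : L.triples.Nodup := by
  have := L.width_le_depth_mul
  rw [triples, List.nodup_append']
  refine ⟨List.nodup_flatMap.2 ⟨fun g _ => by simp, ?_⟩, L.nodup.map ?_, ?_⟩
  · refine List.nodup_range.imp fun {a b} hab => ?_
    simp only [List.disjoint_cons_left, List.mem_cons, Prod.mk.injEq, List.not_mem_nil, or_false]
    exact ⟨by omega, by omega, by simp⟩
  · rintro ⟨s, t⟩ ⟨s', t'⟩ h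
    simpa using h
  · simp only [List.disjoint_left, List.mem_flatMap, List.mem_map, List.mem_cons, List.not_mem_nil,
      or_false]
    rintro _ ⟨g, -, rfl | rfl⟩ ⟨a, -, h⟩ <;> simp at h

theorem length_triples : L.triples.length = (L.width - 1) * 2 + L.arcs.length := by
  simp [triples]

/-- The transition of the VASS that is given by numbers, as in `triples`. -/
def transition (t : ℕ × ℕ × ℕ) : Fin L.states × (Fin 1 → ℤ) × Fin L.states :=
  (Fin.ofNat _ t.1, fun _ => (t.2.1 : ℤ) - 1, Fin.ofNat _ t.2.2)

theorem transition_injOn : Set.InjOn L.transition {t | t ∈ L.triples} := by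
  rintro ⟨s, b, t⟩ h ⟨s', b', t'⟩ h' he
  obtain ⟨hs, -, ht⟩ := triples_lt h
  obtain ⟨hs', -, ht'⟩ := triples_lt h'
  obtain ⟨e1, e2, e3⟩ : Fin.ofNat L.states s = Fin.ofNat _ s' ∧
      (fun _ : Fin 1 => (b : ℤ) - 1) = (fun _ => (b' : ℤ) - 1) ∧
        Fin.ofNat L.states t = Fin.ofNat _ t' := by
    simpa only [transition, Prod.mk.injEq] using he
  have e1 := congrArg Fin.val e1
  have e2 := congrFun e2 0
  have e3 := congrArg Fin.val e3
  simp only [Fin.val_ofNat, Nat.mod_eq_of_lt, hs, hs', ht, ht'] at e1 e3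
  exact Prod.ext e1 (Prod.ext (by simpa using e2) e3)

/-- The transitions of the VASS in the order in which they are listed in the input. -/
def transList : List (Fin L.states × (Fin 1 → ℤ) × Fin L.states) := L.triples.map L.transition

theorem nodup_transList : L.transList.Nodup :=
  L.nodup_triples.map_on fun _ h _ h' e => L.transition_injOn h h' e

/-- The unary 1-VASS with the transitions `triples`. -/
def vass : UnaryVASS 1 (Fin L.states) where
  trans := L.transList.toFinset
  nonempty :=
    have h : (0, 0, 1) ∈ L.triples := mem_triples.2 (.inl ⟨L.one_lt_width, rfl, rfl⟩)
    ⟨_, List.mem_toFinset.2 (List.mem_map_of_mem h)⟩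
  unary := by
    intro _ ht _
    obtain ⟨⟨s, b, t⟩, h, rfl⟩ := List.mem_map.1 (List.mem_toFinset.1 ht)
    obtain ⟨-, hb, -⟩ := triples_lt h
    simp only [transition]
    omega

/-- The size of the VASS. -/
def vassSize : ℕ := L.states + ((L.width - 1) * 2 + L.arcs.length)

theorem size_vass : L.vass.size = L.vassSize := by
  rw [UnaryVASS.size, Fintype.card_fin, vass, List.toFinset_card_of_nodup L.nodup_transList,
    transList, List.length_map, length_triples, vassSize]

/-- The instance asking whether the last layer's state `0` can be reached from the first layer's
state `0`, with the maximal counter value in both configurations. -/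
def vassInput (γ : ℚ) : BoundedVASSInput (linearBound γ) 1 where
  numStates := L.states
  vass := L.vass
  source := (Fin.ofNat _ 0, fun _ => linearBound γ L.vassSize)
  target := (Fin.ofNat _ (L.depth * L.width), fun _ => linearBound γ L.vassSize)
  source_le _ := by rw [size_vass]
  target_le _ := by rw [size_vass]
  transList := L.transList
  nodup := L.nodup_transList
  mem_transList _ := by rw [vass, List.mem_toFinset]

theorem encode_vassInput (γ : ℚ) : (L.vassInput γ).encode =
    [L.states, (L.width - 1) * 2 + L.arcs.length, 0, linearBound γ L.vassSize,
      L.depth * L.width, linearBound γ L.vassSize] ++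
    L.triples.flatMap fun t => [t.1, t.2.1, t.2.2] := by
  have htriple : ∀ t ∈ L.triples, (((L.transition t).1 : ℕ) ::
      (List.ofFn (fun i => ((L.transition t).2.1 i + 1).toNat) ++ [((L.transition t).2.2 : ℕ)])) =
      [t.1, t.2.1, t.2.2] := fun t ht => by
    obtain ⟨hs, -, ht⟩ := triples_lt ht
    simp [transition, Nat.mod_eq_of_lt hs, Nat.mod_eq_of_lt ht]
  rw [← List.flatMap_congr htriple]
  simp [List.flatMap_map, BoundedVASSInput.encode, vassInput, transList, length_triples,
    Nat.mod_eq_of_lt L.last_lt_states]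

variable {L} {γ : ℚ}

theorem step_of_bStep {B : ℕ} {c c' : Fin L.states × (Fin 1 → ℕ)} (h : L.vass.BStep B c c') :
    L.Step B (c.1, c.2 0) (c'.1, c'.2 0) := by
  obtain ⟨h1, h2, u, hu, he⟩ := h
  obtain ⟨⟨s, b, t⟩, ht, hte⟩ := List.mem_map.1 (List.mem_toFinset.1 hu)
  obtain ⟨hs, -, ht'⟩ := triples_lt ht
  simp only [transition, Prod.mk.injEq] at hte
  obtain ⟨e1, rfl, e3⟩ := hte
  have e1 : s = c.1 := by simpa [Nat.mod_eq_of_lt hs] using congrArg Fin.val e1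
  have e3 : t = c'.1 := by simpa [Nat.mod_eq_of_lt ht'] using congrArg Fin.val e3
  have he : (b : ℤ) - 1 = c'.2 0 - c.2 0 := he 0
  exact ⟨b, by simpa only [← e1, ← e3] using ht, by simp only; omega, h1 0, h2 0⟩

theorem bStep_of_step {B : ℕ} {c c' : ℕ × ℕ} (h : L.Step B c c') :
    L.vass.BStep B (Fin.ofNat _ c.1, fun _ => c.2) (Fin.ofNat _ c'.1, fun _ => c'.2) := by
  obtain ⟨b, hb, he, h1, h2⟩ := h
  refine ⟨fun _ => h1, fun _ => h2, _, List.mem_toFinset.2 (List.mem_map_of_mem hb), fun _ => ?_⟩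
  simp only
  omega

theorem inv_of_bReach {B : ℕ} {c : Fin L.states × (Fin 1 → ℕ)}
    (h : L.vass.BReach B (Fin.ofNat _ 0, fun _ => B) c) : L.Inv B c.1 (c.2 0) ∧ c.2 0 ≤ B := by
  induction h with
  | refl => exact ⟨by simpa using Inv.start, le_rfl⟩
  | tail _ hs ih => exact ⟨Inv.step (c := (_, _)) ih.1 (step_of_bStep hs), hs.2.1 0⟩

theorem hasClosedWalk_of_coverability
    (h : (coverabilityProblem (linearBound γ) 1).yes (L.vassInput γ)) : L.HasClosedWalk := by
  obtain ⟨v, hv, hreach⟩ := h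
  have hB : linearBound γ (L.vassInput γ).vass.size = linearBound γ L.vassSize :=
    congrArg _ L.size_vass
  rw [hB] at hreach
  obtain ⟨hinv, hle⟩ := inv_of_bReach hreach
  have hv0 : v 0 = linearBound γ L.vassSize := le_antisymm hle (hv 0)
  refine Inv.hasClosedWalk (B := linearBound γ L.vassSize) ?_
  simpa [vassInput, hv0, Nat.mod_eq_of_lt L.last_lt_states] using hinv

theorem HasClosedWalk.reachability (h : L.HasClosedWalk) (hγ : 0 < γ)
    (hL : γ.den * L.width ≤ L.states) :
    (reachabilityProblem (linearBound γ) 1).yes (L.vassInput γ) := by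
  have hB : linearBound γ (L.vassInput γ).vass.size = linearBound γ L.vassSize :=
    congrArg _ L.size_vass
  have hle : L.width ≤ linearBound γ L.vassSize :=
    le_linearBound hγ (hL.trans (Nat.le_add_right _ _))
  change UnaryVASS.BReach _ (linearBound γ (L.vassInput γ).vass.size) _ _
  rw [hB]
  exact (h.reaches hle).lift (fun c => (Fin.ofNat _ c.1, fun _ => c.2)) fun _ _ => bStep_of_step

end LayeredGraph

namespace CycleReduction

/-! ## The layered graph of the coloured vertices -/

/-- The number of bit tests for the numbers below `2 * m + 1`, among them the numbers of the at most
`2 * m` vertices that lie on one of `m` edges. -/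
def numTests (m : ℕ) : ℕ := 2 * (2 * m + 1).size

/-- The number of colourings. -/
def numColours (k m : ℕ) : ℕ := numTests m ^ (k * k)

/-- The number of coloured vertices; `h * (2 * m + 1) + v` stands for the vertex number `v` with the
colouring `h`. -/
def layerWidth (k m : ℕ) : ℕ := numColours k m * (2 * m + 1)

theorem one_lt_numTests (m : ℕ) : 1 < numTests m := by
  have : 0 < (2 * m + 1).size := Nat.size_pos.2 (by omega)
  rw [numTests]
  omega

theorem one_lt_numColours {k : ℕ} (hk : 0 < k) (m : ℕ) : 1 < numColours k m :=
  Nat.one_lt_pow (by positivity) (one_lt_numTests m)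

theorem one_lt_layerWidth {k : ℕ} (hk : 0 < k) (m : ℕ) : 1 < layerWidth k m :=
  (one_lt_numColours hk m).trans_le (Nat.le_mul_of_pos_right _ (by omega))

instance (k D h j v : ℕ) : Decidable (Admits k D h j v) :=
  inferInstanceAs (Decidable (∀ p < k * k, _ → _))

/-- The vertices on edges have different numbers below `2 * m`, where `m` is the number of edges.
There can be many more vertices altogether than a reduction in time `O(m)` could deal with. -/
structure IsNumbering (x : GraphInput) (num : Fin x.numVertices → ℕ) : Prop where
  fst_lt : ∀ e ∈ x.edges, num e.1 < 2 * x.edges.length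
  snd_lt : ∀ e ∈ x.edges, num e.2 < 2 * x.edges.length
  injOn : Set.InjOn num {v | ∃ e ∈ x.edges, v = e.1 ∨ v = e.2}

/-- The arc for the edge `e` with the colouring `s % numColours k m` in the layer
`s / numColours k m`. If the colouring does not allow the source of `e` in this position of a cycle,
then the arc leads to a dead end. -/
def colouredArc (x : GraphInput) (k : ℕ) (num : Fin x.numVertices → ℕ) (s : ℕ)
    (e : Fin x.numVertices × Fin x.numVertices) : ℕ × ℕ :=
  let m := x.edges.length
  (s * (2 * m + 1) + num e.1, (s + numColours k m) * (2 * m + 1) + num e.2 +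
    if Admits k (numTests m) (s % numColours k m) (s / numColours k m) (num e.1) then 0
    else (k + 1) * layerWidth k m)

/-- The arcs between coloured vertices. -/
def colouredArcs (x : GraphInput) (k : ℕ) (num : Fin x.numVertices → ℕ) : List (ℕ × ℕ) :=
  (List.range (k * numColours k x.edges.length)).flatMap fun s =>
    x.edges.map (colouredArc x k num s)

theorem colouredArc_fst_lt {x : GraphInput} {k s : ℕ} {num : Fin x.numVertices → ℕ}
    (hnum : IsNumbering x num) {e : Fin x.numVertices × Fin x.numVertices} (he : e ∈ x.edges)
    (hs : s < k * numColours k x.edges.length) :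
    (colouredArc x k num s e).1 < k * layerWidth k x.edges.length := by
  rw [layerWidth, ← Nat.mul_assoc]
  exact mul_add_lt_mul_of_lt hs ((hnum.fst_lt e he).trans (Nat.lt_succ_self _))

theorem colouredArc_snd_lt {x : GraphInput} {k s : ℕ} {num : Fin x.numVertices → ℕ}
    (hnum : IsNumbering x num) {e : Fin x.numVertices × Fin x.numVertices} (he : e ∈ x.edges)
    (hs : s < k * numColours k x.edges.length) :
    (colouredArc x k num s e).2 < (2 * k + 2) * layerWidth k x.edges.length := by
  have hlt : (s + numColours k x.edges.length) * (2 * x.edges.length + 1) + num e.2 <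
      (k + 1) * layerWidth k x.edges.length := by
    rw [layerWidth, ← Nat.mul_assoc]
    exact mul_add_lt_mul_of_lt (by rw [Nat.succ_mul]; omega)
      ((hnum.snd_lt e he).trans (Nat.lt_succ_self _))
  rw [colouredArc, (by ring : (2 * k + 2) * layerWidth k x.edges.length =
    (k + 1) * layerWidth k x.edges.length + (k + 1) * layerWidth k x.edges.length)]
  split_ifs <;> simp only <;> omega

theorem colouredArc_inj {x : GraphInput} {k s s' : ℕ} {num : Fin x.numVertices → ℕ}
    (hnum : IsNumbering x num) {e e' : Fin x.numVertices × Fin x.numVertices} (he : e ∈ x.edges)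
    (he' : e' ∈ x.edges) (h : colouredArc x k num s e = colouredArc x k num s' e') :
    s = s' ∧ e = e' := by
  simp only [colouredArc, Prod.mk.injEq] at h
  obtain ⟨h1, h2⟩ := h
  obtain ⟨rfl, hu⟩ := (mul_add_eq_mul_add_iff ((hnum.fst_lt e he).trans (Nat.lt_succ_self _))
    ((hnum.fst_lt e' he').trans (Nat.lt_succ_self _))).1 h1
  rw [hu] at h2
  have hv : num e.2 = num e'.2 := by omega
  exact ⟨rfl, Prod.ext (hnum.injOn ⟨e, he, .inl rfl⟩ ⟨e', he', .inl rfl⟩ hu)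
    (hnum.injOn ⟨e, he, .inr rfl⟩ ⟨e', he', .inr rfl⟩ hv)⟩

theorem nodup_colouredArcs {x : GraphInput} {k : ℕ} {num : Fin x.numVertices → ℕ}
    (hnum : IsNumbering x num) : (colouredArcs x k num).Nodup := by
  refine List.nodup_flatMap.2 ⟨fun s _ => ?_, List.nodup_range.imp fun hs => ?_⟩
  · exact x.nodup.map_on fun e he e' he' h => (colouredArc_inj hnum he he' h).2
  · simp only [Function.onFun, List.disjoint_left, List.mem_map]
    rintro _ ⟨e, he, rfl⟩ ⟨e', he', h⟩
    exact hs (colouredArc_inj hnum he' he h).1.symm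

theorem length_colouredArcs (x : GraphInput) (k : ℕ) (num : Fin x.numVertices → ℕ) :
    (colouredArcs x k num).length = k * numColours k x.edges.length * x.edges.length := by
  simp [colouredArcs]

theorem state_eq (k m s u : ℕ) : s * (2 * m + 1) + u =
    s / numColours k m * layerWidth k m + (s % numColours k m * (2 * m + 1) + u) := by
  conv_lhs => rw [← Nat.div_add_mod s (numColours k m)]
  rw [layerWidth]
  ring

theorem mod_numColours_state_lt {k : ℕ} (hk : 0 < k) {m u : ℕ} (s : ℕ) (hu : u < 2 * m + 1) :
    s % numColours k m * (2 * m + 1) + u < layerWidth k m :=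
  mul_add_lt_mul_of_lt (Nat.mod_lt _ (zero_lt_one.trans (one_lt_numColours hk m))) hu

theorem colouredArc_snd_eq {x : GraphInput} {k : ℕ} (hk : 0 < k) {num : Fin x.numVertices → ℕ}
    {s : ℕ} {e : Fin x.numVertices × Fin x.numVertices}
    (h : (colouredArc x k num s e).2 < (k + 1) * layerWidth k x.edges.length) :
    Admits k (numTests x.edges.length) (s % numColours k x.edges.length)
        (s / numColours k x.edges.length) (num e.1) ∧
      (colouredArc x k num s e).2 =
        (s / numColours k x.edges.length + 1) * layerWidth k x.edges.length +
          (s % numColours k x.edges.length * (2 * x.edges.length + 1) + num e.2) := by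
  have hF := zero_lt_one.trans (one_lt_numColours hk x.edges.length)
  simp only [colouredArc] at h ⊢
  split_ifs at h ⊢ with hadm
  · rw [Nat.add_zero, state_eq k, Nat.add_div_right _ hF, Nat.add_mod_right]
    exact ⟨hadm, rfl⟩
  · omega

/-- The layered graph of the coloured vertices; the parameter `q` pads the set of states. -/
def colouredGraph (x : GraphInput) {k : ℕ} (hk : 0 < k) (q : ℕ) {num : Fin x.numVertices → ℕ}
    (hnum : IsNumbering x num) : LayeredGraph where
  depth := k
  width := layerWidth k x.edges.length
  states := (2 * k + 2 + q) * layerWidth k x.edges.length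
  arcs := colouredArcs x k num
  depth_pos := hk
  one_lt_width := one_lt_layerWidth hk _
  le_states := Nat.mul_le_mul_right _ (by omega)
  nodup := nodup_colouredArcs hnum
  fst_lt a ha := by
    simp only [colouredArcs, List.mem_flatMap, List.mem_range, List.mem_map] at ha
    obtain ⟨s, hs, e, he, rfl⟩ := ha
    exact colouredArc_fst_lt hnum he hs
  snd_lt a ha := by
    simp only [colouredArcs, List.mem_flatMap, List.mem_range, List.mem_map] at ha
    obtain ⟨s, hs, e, he, rfl⟩ := ha
    exact (colouredArc_snd_lt hnum he hs).trans_le (Nat.mul_le_mul_right _ (by omega))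
  snd_div a ha hlt := by
    simp only [colouredArcs, List.mem_flatMap, List.mem_range, List.mem_map] at ha
    obtain ⟨s, -, e, he, rfl⟩ := ha
    have hu := mod_numColours_state_lt hk s ((hnum.fst_lt e he).trans (Nat.lt_succ_self _))
    have hv := mod_numColours_state_lt hk s ((hnum.snd_lt e he).trans (Nat.lt_succ_self _))
    rw [(colouredArc_snd_eq hk hlt).2, mul_add_div_eq_of_lt hv, colouredArc, state_eq k,
      mul_add_div_eq_of_lt hu]

section Cycles

variable {x : GraphInput} {k : ℕ} {num : Fin x.numVertices → ℕ}

theorem mem_colouredArcs_iff (hk : 0 < k) (hnum : IsNumbering x num) {j g g' : ℕ} (hj : j < k)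
    (hg : g < layerWidth k x.edges.length) (hg' : g' < layerWidth k x.edges.length) :
    (j * layerWidth k x.edges.length + g, (j + 1) * layerWidth k x.edges.length + g') ∈
        colouredArcs x k num ↔
      ∃ h < numColours k x.edges.length, ∃ e ∈ x.edges,
        Admits k (numTests x.edges.length) h j (num e.1) ∧
          g = h * (2 * x.edges.length + 1) + num e.1 ∧
            g' = h * (2 * x.edges.length + 1) + num e.2 := by
  have hF := zero_lt_one.trans (one_lt_numColours hk x.edges.length)
  simp only [colouredArcs, List.mem_flatMap, List.mem_range, List.mem_map]
  constructor
  · rintro ⟨s, -, e, he, h⟩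
    have hu := mod_numColours_state_lt hk s ((hnum.fst_lt e he).trans (Nat.lt_succ_self _))
    have hv := mod_numColours_state_lt hk s ((hnum.snd_lt e he).trans (Nat.lt_succ_self _))
    obtain ⟨hadm, h2⟩ := colouredArc_snd_eq hk (num := num) (s := s) (e := e)
      (by rw [h]; exact mul_add_lt_mul_of_lt (by omega) hg')
    have h1 := (state_eq k x.edges.length s (num e.1)).symm.trans (congrArg Prod.fst h)
    rw [h] at h2
    obtain ⟨rfl, rfl⟩ := (mul_add_eq_mul_add_iff hu hg).1 h1
    obtain ⟨-, rfl⟩ := (mul_add_eq_mul_add_iff hg' hv).1 h2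
    exact ⟨_, Nat.mod_lt _ hF, e, he, hadm, rfl, rfl⟩
  · rintro ⟨h, hh, e, he, hadm, rfl, rfl⟩
    have hmod : (j * numColours k x.edges.length + h) % numColours k x.edges.length = h :=
      Nat.mul_add_mod_of_lt hh
    have hdiv : (j * numColours k x.edges.length + h) / numColours k x.edges.length = j :=
      mul_add_div_eq_of_lt hh
    refine ⟨j * numColours k x.edges.length + h, mul_add_lt_mul_of_lt hj hh, e, he, ?_⟩
    rw [colouredArc, hmod, hdiv, if_pos hadm, layerWidth]
    exact Prod.ext (by ring) (by ring)

/-- A walk of the layered graph cannot change its colouring. -/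
theorem exists_edge_of_isWalk (hk : 0 < k) (q : ℕ) (hnum : IsNumbering x num) {w : ℕ → ℕ}
    (hw : (colouredGraph x hk q hnum).IsWalk k w) {i : ℕ} (hi : i < k) :
    ∃ e ∈ x.edges,
      Admits k (numTests x.edges.length) (w 0 / (2 * x.edges.length + 1)) i (num e.1) ∧
        num e.1 = w i % (2 * x.edges.length + 1) ∧
          num e.2 = w (i + 1) % (2 * x.edges.length + 1) := by
  have hedge {i : ℕ} (hi : i < k) := (mem_colouredArcs_iff hk hnum hi (hw.1 i hi.le)
    (hw.1 (i + 1) hi)).1 (hw.2 i hi)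
  have hdiv {h v : ℕ} (hv : v < 2 * x.edges.length) :
      (h * (2 * x.edges.length + 1) + v) / (2 * x.edges.length + 1) = h :=
    mul_add_div_eq_of_lt (hv.trans (Nat.lt_succ_self _))
  have hmod {h v : ℕ} (hv : v < 2 * x.edges.length) :
      (h * (2 * x.edges.length + 1) + v) % (2 * x.edges.length + 1) = v :=
    Nat.mul_add_mod_of_lt (hv.trans (Nat.lt_succ_self _))
  have hcolour : ∀ i < k, w i / (2 * x.edges.length + 1) = w 0 / (2 * x.edges.length + 1) := by
    intro i
    induction i with
    | zero => exact fun _ => rfl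
    | succ i ih =>
      intro hi
      obtain ⟨h, -, e, he, -, h1, h2⟩ := hedge (i := i) (by omega)
      rw [← ih (by omega), h1, h2, hdiv (hnum.fst_lt e he), hdiv (hnum.snd_lt e he)]
  obtain ⟨h, -, e, he, hadm, h1, h2⟩ := hedge hi
  rw [← hcolour i hi, h1, h2, hdiv (hnum.fst_lt e he), hmod (hnum.fst_lt e he),
    hmod (hnum.snd_lt e he)]
  exact ⟨e, he, hadm, rfl, rfl⟩

theorem hasKCycle_of_hasClosedWalk (hk : 0 < k) (q : ℕ) (hnum : IsNumbering x num)
    (h : (colouredGraph x hk q hnum).HasClosedWalk) : x.graph.HasKCycle k := by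
  obtain ⟨w, hw, hw0⟩ := h
  have hw0 : w 0 = w k := hw0
  choose e he hadm hu hv using fun i : Fin k => exists_edge_of_isWalk hk q hnum hw i.2
  refine ⟨fun i => (e i).1, fun i j hij => ?_, fun i j hij => ?_⟩
  · by_contra hne
    exact (hadm i).ne i.2 j.2 (Fin.val_ne_of_ne hne) (hadm j) (congrArg num hij)
  · have hwj : w j = w (i + 1) := by
      rw [hij]
      obtain hik | hik := (Nat.succ_le_of_lt i.2).lt_or_eq
      · rw [Nat.mod_eq_of_lt hik]
      · rw [← Nat.succ_eq_add_one, hik, Nat.mod_self, hw0]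
    have hnext : (e j).1 = (e i).2 :=
      hnum.injOn ⟨_, he j, .inl rfl⟩ ⟨_, he i, .inr rfl⟩ (by rw [hu, hv, hwj])
    simp only [hnext]
    exact (x.mem_edges _ _).1 (he i)

theorem hasClosedWalk_of_hasKCycle (hk : 0 < k) (q : ℕ) (hnum : IsNumbering x num)
    (h : x.graph.HasKCycle k) : (colouredGraph x hk q hnum).HasClosedWalk := by
  obtain ⟨c, hinj, hadj⟩ := h
  let v (i : ℕ) : Fin x.numVertices := c ⟨i % k, Nat.mod_lt _ hk⟩
  have hedge (i : ℕ) : (v i, v (i + 1)) ∈ x.edges :=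
    (x.mem_edges _ _).2 (hadj _ _ (by simp only [Nat.mod_add_mod]))
  have hlt (i : ℕ) : num (v i) < 2 * x.edges.length + 1 :=
    (hnum.fst_lt _ (hedge i)).trans (Nat.lt_succ_self _)
  have hnumInj : Set.InjOn (fun i => num (v i)) (Set.Iio k) := fun i hi j hj hij => by
    have hcc := hinj (hnum.injOn ⟨_, hedge i, .inl rfl⟩ ⟨_, hedge j, .inl rfl⟩ hij)
    simpa only [Fin.mk.injEq, Nat.mod_eq_of_lt (Set.mem_Iio.1 hi),
      Nat.mod_eq_of_lt (Set.mem_Iio.1 hj)] using hcc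
  obtain ⟨h, hh, hadm⟩ := exists_admits _ (fun i _ => hlt i) hnumInj
  have hwlt (i : ℕ) : h * (2 * x.edges.length + 1) + num (v i) < layerWidth k x.edges.length :=
    mul_add_lt_mul_of_lt hh (hlt i)
  refine ⟨fun i => h * (2 * x.edges.length + 1) + num (v i),
    ⟨fun i _ => hwlt i, fun i hi => ?_⟩, ?_⟩
  · exact (mem_colouredArcs_iff hk hnum hi (hwlt i) (hwlt (i + 1))).2
      ⟨h, hh, _, hedge i, hadm i hi, rfl, rfl⟩
  · simp [v, colouredGraph]

end Cycles

end CycleReduction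

namespace WordRAM

/-! ## Arithmetic expressions and output -/

namespace Expr

section Arithmetic

variable {V : Type*}

instance (n : ℕ) : OfNat (Expr V) n := ⟨.lit n⟩

instance : Add (Expr V) := ⟨.bin .add nofun⟩

instance : Sub (Expr V) := ⟨.bin .sub nofun⟩

instance : Mul (Expr V) := ⟨.bin .mul nofun⟩

instance : Div (Expr V) := ⟨.bin .div nofun⟩

instance : Mod (Expr V) := ⟨.bin .mod nofun⟩

instance : XorOp (Expr V) := ⟨.bin .xor nofun⟩

instance : ShiftRight (Expr V) := ⟨.bin .shr nofun⟩

instance : Pow (Expr V) ℕ := ⟨fun e n => n.rec 1 fun _ p => p * e⟩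

/-- The sum of the expressions in a list. -/
def sum (l : List (Expr V)) : Expr V := l.foldr (· + ·) 0

variable (σ : Store V) (a b : Expr V) (n : ℕ) (x : V)

@[simp] theorem eval_lit : (lit n : Expr V).eval σ = n := rfl

@[simp] theorem eval_ofNat : (ofNat(n) : Expr V).eval σ = ofNat(n) := rfl

@[simp] theorem eval_var : (var x).eval σ = σ.var x := rfl

@[simp] theorem eval_load : (load a).eval σ = σ.mem (a.eval σ) := rfl

@[simp] theorem eval_add : (a + b).eval σ = a.eval σ + b.eval σ := rfl

@[simp] theorem eval_sub : (a - b).eval σ = a.eval σ - b.eval σ := rfl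

@[simp] theorem eval_mul : (a * b).eval σ = a.eval σ * b.eval σ := rfl

@[simp] theorem eval_div : (a / b).eval σ = a.eval σ / b.eval σ := rfl

@[simp] theorem eval_mod : (a % b).eval σ = a.eval σ % b.eval σ := rfl

@[simp] theorem eval_xor : (a ^^^ b).eval σ = a.eval σ ^^^ b.eval σ := rfl

@[simp] theorem eval_shiftRight : (a >>> b).eval σ = a.eval σ >>> b.eval σ := rfl

@[simp] theorem eval_pow : (a ^ n).eval σ = a.eval σ ^ n := by
  induction n with
  | zero => rfl
  | succ n ih =>
    rw [pow_succ, ← ih]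
    rfl

@[simp] theorem eval_sum (l : List (Expr V)) : (sum l).eval σ = (l.map (eval σ)).sum := by
  induction l with
  | nil => rfl
  | cons a l ih => rw [List.map_cons, List.sum_cons, ← ih]; rfl

end Arithmetic

end Expr

end WordRAM

namespace CycleReduction

open WordRAM

/-! ## Output -/

section Output

/-- The variables of the reduction: the first cell behind the output written so far, the number of
bit tests, and a loop counter. -/
inductive Var where
  | ptr | tests | idx
  deriving DecidableEq, Encodable

/-- The memory `f` with the list `l` from the cell `β` on, and zeros behind. -/
def layout (f : ℕ → ℕ) (β : ℕ) (l : List ℕ) (a : ℕ) : ℕ :=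
  if a < β then f a else l.getD (a - β) 0

theorem update_layout (f : ℕ → ℕ) (β : ℕ) (l : List ℕ) (v : ℕ) :
    Function.update (layout f β l) (β + l.length) v = layout f β (l ++ [v]) := by
  funext a
  rcases lt_trichotomy a (β + l.length) with h | rfl | h
  · rw [Function.update_of_ne h.ne]
    unfold layout
    split_ifs with ha
    · rfl
    · rw [List.getD_append _ _ _ _ (by omega)]
  · simp [layout]
  · rw [Function.update_of_ne h.ne', layout, layout, if_neg (by omega), if_neg (by omega),
      List.getD_eq_default _ _ (by omega), List.getD_eq_default _ _ (by simp; omega)]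

variable {f : ℕ → ℕ} {β D c i N : ℕ} {full l : List ℕ}

/-- The store after the output `l`, when there are `D` bit tests and the counter is `i`. -/
def stage (f : ℕ → ℕ) (β D : ℕ) (l : List ℕ) (i : ℕ) : Store Var where
  var
    | .ptr => β + l.length
    | .tests => D
    | .idx => i
  mem := layout f β l

theorem set_idx_stage (j : ℕ) : (stage f β D l i).set .idx j = stage f β D l j := by
  ext x
  · cases x <;> rfl
  · rfl

theorem write_stage (v : ℕ) :
    ((stage f β D l i).write (β + l.length) v).set .ptr (β + (l ++ [v]).length) =
      stage f β D (l ++ [v]) i := by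
  ext x
  · cases x <;> rfl
  · exact congrFun (update_layout f β l v) x

/-- Write the values of the expressions to the output. -/
def emit : List (Expr Var) → Cmd Var
  | [] => .assign .ptr (.var .ptr)
  | e :: es => .seq (.store (.var .ptr) e) (.seq (.assign .ptr (.var .ptr + 1)) (emit es))

/-- The running time of `emit`. -/
def emitTime (es : List (Expr Var)) : ℕ := (es.map fun e => e.len + 6).sum + 2

theorem ends_emit {es : List (Expr Var)} {vs : List ℕ}
    (hfull : β + full.length < 2 ^ c) (hword : ∀ v ∈ full, v < 2 ^ c)
    (hes : ∀ l, es.map (Expr.eval (stage f β D l i)) = vs) (hl : l ++ vs <+: full) :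
    (emit es).Ends c (emitTime es) (stage f β D l i) (· = stage f β D (l ++ vs) i) := by
  induction es generalizing l vs with
  | nil =>
    obtain rfl : [] = vs := hes []
    rw [List.append_nil] at hl ⊢
    refine Cmd.ends_assign ?_ ?_
    · exact (Nat.add_le_add_left hl.length_le β).trans_lt hfull
    · ext x
      · cases x <;> rfl
      · rfl
  | cons e es ih =>
    obtain ⟨v, vs, rfl⟩ : ∃ v ws, vs = v :: ws := ⟨_, _, (hes []).symm⟩
    have he (l) : e.eval (stage f β D l i) = v := (List.cons_eq_cons.1 (hes l)).1
    rw [List.append_cons] at hl ⊢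
    have hl' : l ++ [v] <+: full := (List.prefix_append _ _).trans hl
    have hstore : (Cmd.store (.var .ptr) e).Ends c (e.len + 2) (stage f β D l i)
        (· = (stage f β D l i).write (β + l.length) v) :=
      (Cmd.ends_store (by rw [he]; exact hword v (hl'.subset (by simp)))
        (by rw [he]; rfl)).mono (by simp only [Expr.len]; omega) fun _ h => h
    have hptr (τ : Store Var) (hτ : τ = (stage f β D l i).write (β + l.length) v) :
        (Cmd.assign .ptr (.var .ptr + 1)).Ends c 4 τ (· = stage f β D (l ++ [v]) i) := by
      have heval : (.var .ptr + 1 : Expr Var).eval τ = β + (l ++ [v]).length := by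
        subst hτ
        simp [Store.write, stage, Nat.add_assoc]
      refine Cmd.ends_assign ?_ ?_
      · rw [heval]
        exact (Nat.add_le_add_left hl'.length_le β).trans_lt hfull
      · rw [heval, hτ, write_stage]
    refine (hstore.seq fun τ hτ => (hptr τ hτ).seq (t := emitTime es) fun τ' hτ' => ?_).mono ?_
      fun _ h => h
    · subst hτ'
      exact ih (fun l => (List.cons_eq_cons.1 (hes l)).2) hl
    · simp only [emitTime, List.map_cons, List.sum_cons]
      omega

theorem ends_forRange_emit {e : Expr Var} {es : List (Expr Var)} {g : ℕ → List ℕ}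
    (hfull : β + full.length < 2 ^ c) (hword : ∀ v ∈ full, v < 2 ^ c) (hN : N < 2 ^ c)
    (he : ∀ l i, e.eval (stage f β D l i) = N)
    (hes : ∀ i < N, ∀ l, es.map (Expr.eval (stage f β D l i)) = g i)
    (hl : l ++ (List.range N).flatMap g <+: full) :
    (Cmd.forRange .idx e (emit es)).Ends c ((N + 1) * (e.len + emitTime es + 8))
      (stage f β D l i) (· = stage f β D (l ++ (List.range N).flatMap g) N) := by
  refine (Cmd.ends_forRange (t := emitTime es)
    (I := fun j τ => τ = stage f β D (l ++ (List.range j).flatMap g) j) hN ?_ ?_ ?_).mono ?_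
    fun _ h => h
  · rw [set_idx_stage, List.range_zero, List.flatMap_nil, List.append_nil]
  · rintro j _ rfl
    exact he _ _
  · rintro j hj _ - rfl
    have hrange : List.range (j + 1) <+: List.range N := by
      obtain ⟨d, rfl⟩ := Nat.exists_eq_add_of_le (Nat.succ_le_of_lt hj)
      exact ⟨_, List.range_add.symm⟩
    refine (ends_emit hfull hword (hes j hj) ?_).mono le_rfl ?_
    · refine List.IsPrefix.trans ?_ hl
      rw [List.append_assoc, List.prefix_append_right_inj]
      simpa [List.range_succ] using hrange.flatMap g
    · rintro _ rfl
      refine ⟨rfl, ?_⟩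
      rw [set_idx_stage]
      simp [List.range_succ]
  · rw [Nat.succ_mul]
    omega

end Output

/-! ## Preprocessing -/

section Preprocessing

variable {x : GraphInput} {f : ℕ → ℕ} {c i j : ℕ}

/-- The number at which the list of edges in the input has the endpoint `i`, where the edge number
`e` has the endpoints `2 * e` and `2 * e + 1`. -/
def endpoint (x : GraphInput) (i : ℕ) : ℕ := x.encode.getD (i + 2) 0

/-- The first memory cell behind the input and a table with a cell for each vertex. -/
def outputStart (x : GraphInput) : ℕ := 2 * x.edges.length + 2 + x.numVertices

theorem getD_flatMap_pair {α : Type*} (g g' : α → ℕ) (l : List α) (hi : i < l.length) :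
    (l.flatMap fun e => [g e, g' e]).getD (2 * i) 0 = g l[i] ∧
      (l.flatMap fun e => [g e, g' e]).getD (2 * i + 1) 0 = g' l[i] := by
  induction l generalizing i with
  | nil => exact absurd hi (Nat.not_lt_zero i)
  | cons a l ih =>
    cases i with
    | zero => simp
    | succ i => simpa [Nat.mul_succ] using ih (Nat.lt_of_succ_lt_succ hi)

theorem endpoint_two_mul (hi : i < x.edges.length) : endpoint x (2 * i) = x.edges[i].1 :=
  (getD_flatMap_pair _ _ _ hi).1

theorem endpoint_two_mul_add_one (hi : i < x.edges.length) :
    endpoint x (2 * i + 1) = x.edges[i].2 :=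
  (getD_flatMap_pair _ _ _ hi).2

theorem endpoint_lt (hi : i < 2 * x.edges.length) : endpoint x i < x.numVertices := by
  obtain ⟨e, rfl | rfl⟩ := Nat.even_or_odd' i
  · rw [endpoint_two_mul (by omega)]
    exact Fin.is_lt _
  · rw [endpoint_two_mul_add_one (by omega)]
    exact Fin.is_lt _

theorem exists_endpoint_eq {v : Fin x.numVertices} (hv : ∃ e ∈ x.edges, v = e.1 ∨ v = e.2) :
    ∃ i < 2 * x.edges.length, endpoint x i = v := by
  obtain ⟨e, he, hv⟩ := hv
  obtain ⟨i, hi, rfl⟩ := List.mem_iff_getElem.1 he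
  obtain rfl | rfl := hv
  · exact ⟨2 * i, by omega, endpoint_two_mul hi⟩
  · exact ⟨2 * i + 1, by omega, endpoint_two_mul_add_one hi⟩

theorem length_encode (x : GraphInput) : x.encode.length = 2 * x.edges.length + 2 := by
  simp [GraphInput.encode, Nat.mul_comm]

/-- The memory after the first `j` steps of the numbering of the vertices: the table contains, for
each of the first `j` endpoints, a number below `j` at which it is listed. -/
structure IsTable (x : GraphInput) (j : ℕ) (f : ℕ → ℕ) : Prop where
  eq_getD (a : ℕ) (ha : a < 2 * x.edges.length + 2 ∨ outputStart x ≤ a) : f a = x.encode.getD a 0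
  exists_eq (i : ℕ) (hi : i < j) : ∃ l < j, endpoint x l = endpoint x i ∧
    f (2 * x.edges.length + 2 + endpoint x i) = l

namespace IsTable

theorem zero (x : GraphInput) : IsTable x 0 fun a => x.encode.getD a 0 :=
  ⟨fun _ _ => rfl, fun _ hi => absurd hi (Nat.not_lt_zero _)⟩

theorem update (h : IsTable x j f) (hj : j < 2 * x.edges.length) :
    IsTable x (j + 1) (Function.update f (2 * x.edges.length + 2 + endpoint x j) j) where
  eq_getD a ha := by
    have : endpoint x j < x.numVertices := endpoint_lt hj
    rw [Function.update_of_ne (by rw [outputStart] at ha; omega), h.eq_getD a ha]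
  exists_eq i hi := by
    by_cases hij : endpoint x i = endpoint x j
    · exact ⟨j, Nat.lt_succ_self j, hij.symm, by rw [hij, Function.update_self]⟩
    · have hne : i ≠ j := fun h => hij (congrArg _ h)
      obtain ⟨l, hl, he, hf⟩ := h.exists_eq i (by omega)
      exact ⟨l, hl.trans (Nat.lt_succ_self j), he, by rwa [Function.update_of_ne (by omega)]⟩

theorem zero_eq (h : IsTable x j f) : f 0 = x.numVertices := h.eq_getD 0 (.inl (by omega))

theorem one_eq (h : IsTable x j f) : f 1 = x.edges.length := h.eq_getD 1 (.inl (by omega))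

theorem add_two_eq (h : IsTable x j f) (hi : i < 2 * x.edges.length) :
    f (i + 2) = endpoint x i :=
  h.eq_getD _ (.inl (by omega))

theorem layout_nil (h : IsTable x j f) : layout f (outputStart x) [] = f := by
  funext a
  rw [layout]
  split_ifs with ha
  · rfl
  · rw [h.eq_getD a (.inr (not_lt.1 ha)), List.getD_nil, List.getD_eq_default]
    rw [length_encode]
    rw [outputStart] at ha
    omega

/-- The numbering in the table. -/
def num (x : GraphInput) (f : ℕ → ℕ) (v : Fin x.numVertices) : ℕ :=
  f (2 * x.edges.length + 2 + v)

theorem isNumbering (h : IsTable x (2 * x.edges.length) f) : IsNumbering x (num x f) := by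
  have hnum (v) (hv : ∃ e ∈ x.edges, v = e.1 ∨ v = e.2) :
      num x f v < 2 * x.edges.length ∧ endpoint x (num x f v) = v := by
    obtain ⟨i, hi, hiv⟩ := exists_endpoint_eq hv
    obtain ⟨l, hl, he, hf⟩ := h.exists_eq i hi
    rw [num, ← hiv, hf]
    exact ⟨hl, he⟩
  refine ⟨fun e he => (hnum e.1 ⟨e, he, .inl rfl⟩).1, fun e he => (hnum e.2 ⟨e, he, .inr rfl⟩).1,
    fun u hu v hv huv => Fin.ext ?_⟩
  rw [← (hnum u hu).2, huv, (hnum v hv).2]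

end IsTable

/-- The number of edges, which is part of the input. -/
def numEdges : Expr Var := .load 1

/-- Strictly larger than all numbers of vertices on edges. -/
def radix : Expr Var := 2 * numEdges + 1

/-- The entry of the table for a vertex. -/
def lookup (v : Expr Var) : Expr Var := .load (2 * numEdges + 2 + v)

/-- Fill the table. -/
def numberVertices : Cmd Var :=
  .forRange .idx (2 * numEdges)
    (.store (2 * numEdges + 2 + .load (.var .idx + 2)) (.var .idx))

/-- Count one binary digit of the loop counter. -/
def countDigit : Cmd Var :=
  .seq (.assign .idx (.var .idx / 2)) (.assign .tests (.var .tests + 2))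

/-- Compute `numTests`, given the number of edges. -/
def countTests : Cmd Var :=
  .seq (.assign .idx radix) <| .seq (.assign .tests 0) <| .loop (.var .idx) countDigit

theorem ends_numberVertices (hc : outputStart x < 2 ^ c) {σ : Store Var}
    (hσ : σ.mem = fun a => x.encode.getD a 0) :
    numberVertices.Ends c (50 * (x.edges.length + 1)) σ
      fun τ => IsTable x (2 * x.edges.length) τ.mem := by
  rw [outputStart] at hc
  refine (Cmd.ends_forRange (N := 2 * x.edges.length) (t := 13)
    (I := fun j τ => IsTable x j τ.mem) (by omega) ?_ ?_ ?_).mono ?_ fun _ h => h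
  · simpa only [Store.set, hσ] using IsTable.zero x
  · intro j τ hτ
    simp [numEdges, hτ.one_eq]
  · intro j hj τ hidx hτ
    refine Cmd.ends_store ?_ ⟨hidx, ?_⟩
    · rw [Expr.eval_var, hidx]
      omega
    · simpa [Store.write, Store.set, numEdges, hidx, hτ.one_eq, hτ.add_two_eq hj]
        using hτ.update hj
  · simp only [numEdges]
    change 2 * x.edges.length * (4 + 13 + 8) + 4 + 5 ≤ _
    omega

theorem ends_countDigit {σ : Store Var} (hidx : σ.var .idx < 2 ^ c)
    (htests : σ.var .tests + 2 < 2 ^ c) :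
    countDigit.Ends c 8 σ fun τ => τ.mem = σ.mem ∧ τ.var .idx = σ.var .idx / 2 ∧
      τ.var .tests = σ.var .tests + 2 := by
  have hhalf : (Cmd.assign Var.idx (.var .idx / 2)).Ends c 4 σ fun τ => τ.mem = σ.mem ∧
      τ.var .idx = σ.var .idx / 2 ∧ τ.var .tests = σ.var .tests :=
    Cmd.ends_assign ((Nat.div_le_self _ _).trans_lt hidx)
      ⟨rfl, by simp [Store.set], by simp [Store.set]⟩
  refine hhalf.seq (t := 4) fun τ hτ => Cmd.ends_assign ?_ ⟨hτ.1, ?_, ?_⟩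
  · simpa [hτ.2.2] using htests
  · simpa [Store.set] using hτ.2.1
  · simp [Store.set, hτ.2.2]

theorem ends_countTests (hm : 2 * x.edges.length + 1 < 2 ^ c)
    (hD : numTests x.edges.length < 2 ^ c) {σ : Store Var} (hσ : σ.mem 1 = x.edges.length) :
    countTests.Ends c (50 * (x.edges.length + 1)) σ
      fun τ => τ.mem = σ.mem ∧ τ.var .tests = numTests x.edges.length := by
  set R := 2 * x.edges.length + 1 with hR
  let I (j : ℕ) (τ : Store Var) : Prop :=
    τ.mem = σ.mem ∧ τ.var .idx = R / 2 ^ j ∧ τ.var .tests = 2 * j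
  have hloop (τ) (hτ : I 0 τ) :
      (Cmd.loop (.var .idx) countDigit).Ends c (R.size * 11 + 2) τ (I R.size) := by
    refine Cmd.ends_loop (t := 8) hτ (fun τ hτ => ?_) fun j hj τ hτ => ⟨?_, ?_⟩
    · rw [Expr.eval_var, hτ.2.1, Nat.div_eq_of_lt (Nat.lt_size_self R)]
    · rw [Expr.eval_var, hτ.2.1]
      exact (Nat.div_pos (Nat.lt_size.1 hj) (by positivity)).ne'
    · rw [numTests, ← hR] at hD
      refine (ends_countDigit ?_ ?_).mono le_rfl fun τ' hτ' => ⟨hτ'.1.trans hτ.1, ?_, ?_⟩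
      · rw [hτ.2.1]
        exact (Nat.div_le_self _ _).trans_lt hm
      · omega
      · rw [hτ'.2.1, hτ.2.1, Nat.div_div_eq_div_mul, pow_succ]
      · rw [hτ'.2.2, hτ.2.2, Nat.mul_succ]
  have hsize : R.size ≤ R := Nat.size_le.2 Nat.lt_two_pow_self
  have hinit : (Cmd.assign Var.idx radix).Ends c 7 σ fun τ => τ.mem = σ.mem ∧ τ.var .idx = R :=
    Cmd.ends_assign (by simpa [radix, numEdges, hσ] using hm)
      ⟨rfl, by simp [Store.set, radix, numEdges, hσ, hR]⟩
  refine (hinit.seq fun τ hτ => Cmd.Ends.seq (s := 2) (Cmd.ends_assign ?_ ?_) hloop).mono ?_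
    fun τ hτ => ⟨hτ.1, hτ.2.2⟩
  · simp
  · exact ⟨hτ.1, by simpa [Store.set] using hτ.2, by simp [Store.set]⟩
  · omega

end Preprocessing

/-! ## The expressions in the output -/

section OutputExpressions

/-- The first memory cell of the output. -/
def start : Expr Var := 2 * numEdges + 2 + .load 0

/-- The number of colourings. -/
def colours (k : ℕ) : Expr Var := (.var .tests : Expr Var) ^ (k * k)

/-- The number of coloured vertices. -/
def coloured (k : ℕ) : Expr Var := colours k * radix

/-- The layer and the colouring of an arc; the counter runs through the pairs of them and an
edge. -/
def position : Expr Var := .var .idx / numEdges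

/-- The number of the source of the edge. -/
def source : Expr Var := lookup (.load (2 * (.var .idx % numEdges) + 2))

/-- The number of the target of the edge. -/
def target : Expr Var := lookup (.load (2 * (.var .idx % numEdges) + 3))

/-- `1` for equal numbers, and `0` otherwise. -/
def eqTest (a b : Expr Var) : Expr Var := 1 - (a ^^^ b)

/-- Nonzero if the digit `p` of the colouring does not allow the source of the edge. -/
def misfit (k p : ℕ) : Expr Var :=
  let layer := position / colours k
  let d := position % colours k / (.var .tests : Expr Var) ^ p % .var .tests
  (eqTest layer (.lit (p / k)) + eqTest layer (.lit (p % k))) *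
    eqTest ((source >>> (d / 2) + d) % 2) (eqTest layer (.lit (p / k)))

/-- Nonzero if the colouring does not allow the source of the edge. -/
def misfits (k : ℕ) : Expr Var := .sum ((List.range (k * k)).map (misfit k))

/-- The transition for an arc of the coloured graph. -/
def arcExprs (k : ℕ) : List (Expr Var) :=
  [position * radix + source, 1, (position + colours k) * radix + target +
    (1 - (1 - misfits k)) * (.lit (k + 1) * coloured k)]

/-- A decreasing transition in the first layer and an increasing one in the last layer. -/
def chainExprs (k : ℕ) : List (Expr Var) :=
  [.var .idx, 0, .var .idx + 1,
    .lit k * coloured k + (.var .idx + 1), 2, .lit k * coloured k + .var .idx]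

/-- The numbers of states and transitions, and the two configurations. -/
def headerExprs (k : ℕ) (γ : ℚ) : List (Expr Var) :=
  let states := .lit (2 * k + 2 + γ.den) * coloured k
  let transitions := (coloured k - 1) * 2 + .lit k * colours k * numEdges
  let bound := .lit γ.num.toNat * (states + transitions) / .lit γ.den
  [states, transitions, 0, bound, .lit k * coloured k, bound]

/-- The store after the preprocessing of the graph `x` and the output `l`, where `f` contains the
input and the table. -/
def prepared (x : GraphInput) (f : ℕ → ℕ) (l : List ℕ) (i : ℕ) : Store Var :=
  stage f (outputStart x) (numTests x.edges.length) l i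

variable {x : GraphInput} {f : ℕ → ℕ} {l : List ℕ} {k i s e : ℕ}

theorem mem_prepared {a : ℕ} (ha : a < outputStart x) : (prepared x f l i).mem a = f a :=
  if_pos ha

theorem var_idx_prepared : (prepared x f l i).var .idx = i := rfl

theorem var_tests_prepared :
    (prepared x f l i).var .tests = numTests x.edges.length := rfl

theorem eval_colours : (colours k).eval (prepared x f l i) = numColours k x.edges.length :=
  Expr.eval_pow _ _ _

theorem eval_eqTest {σ : Store Var} {a b : Expr Var} :
    (eqTest a b).eval σ = if a.eval σ = b.eval σ then 1 else 0 := by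
  have hxor := Nat.xor_eq_zero_iff (x := a.eval σ) (y := b.eval σ)
  simp only [eqTest, Expr.eval_sub, Expr.eval_xor, Expr.eval_ofNat]
  split_ifs with h
  · rw [hxor.2 h]
  · have := mt hxor.1 h
    omega

variable (hf : IsTable x (2 * x.edges.length) f)
include hf

theorem eval_numEdges : numEdges.eval (prepared x f l i) = x.edges.length := by
  have h1 : 1 < outputStart x := by
    rw [outputStart]
    omega
  rw [numEdges, Expr.eval_load, Expr.eval_ofNat, mem_prepared h1, hf.one_eq]

theorem eval_radix : radix.eval (prepared x f l i) = 2 * x.edges.length + 1 := by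
  simp [radix, eval_numEdges hf]

theorem eval_coloured : (coloured k).eval (prepared x f l i) = layerWidth k x.edges.length := by
  rw [coloured, Expr.eval_mul, eval_colours, eval_radix hf, layerWidth]

theorem eval_lookup {a : Expr Var} {v : Fin x.numVertices}
    (ha : a.eval (prepared x f l i) = v) :
    (lookup a).eval (prepared x f l i) = IsTable.num x f v := by
  have := v.2
  simp only [lookup, Expr.eval_load, Expr.eval_add, Expr.eval_mul, Expr.eval_ofNat,
    eval_numEdges hf, ha]
  exact mem_prepared (by rw [outputStart]; omega)

theorem eval_endpoint {a : Expr Var} {j : ℕ} (hj : j < 2 * x.edges.length)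
    (ha : a.eval (prepared x f l i) = j + 2) :
    (Expr.load a).eval (prepared x f l i) = endpoint x j := by
  rw [Expr.eval_load, ha, mem_prepared (by rw [outputStart]; omega), hf.add_two_eq hj]

theorem eval_position (he : e < x.edges.length) :
    position.eval (prepared x f l (s * x.edges.length + e)) = s := by
  rw [position, Expr.eval_div, Expr.eval_var, var_idx_prepared, eval_numEdges hf,
    mul_add_div_eq_of_lt he]

theorem eval_source (he : e < x.edges.length) :
    source.eval (prepared x f l (s * x.edges.length + e)) = IsTable.num x f x.edges[e].1 := by
  refine eval_lookup hf ((eval_endpoint hf (j := 2 * e) (by omega) ?_).trans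
    (endpoint_two_mul he))
  simp [var_idx_prepared, eval_numEdges hf, Nat.mul_add_mod_of_lt he]

theorem eval_target (he : e < x.edges.length) :
    target.eval (prepared x f l (s * x.edges.length + e)) = IsTable.num x f x.edges[e].2 := by
  refine eval_lookup hf ((eval_endpoint hf (j := 2 * e + 1) (by omega) ?_).trans
    (endpoint_two_mul_add_one he))
  simp [var_idx_prepared, eval_numEdges hf, Nat.mul_add_mod_of_lt he]

theorem eval_misfit_eq_zero_iff (p : ℕ) (he : e < x.edges.length) :
    (misfit k p).eval (prepared x f l (s * x.edges.length + e)) = 0 ↔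
      (s / numColours k x.edges.length = p / k ∨ s / numColours k x.edges.length = p % k →
        (bitTest (digit (numTests x.edges.length) (s % numColours k x.edges.length) p)
          (IsTable.num x f x.edges[e].1) = 0 ↔ s / numColours k x.edges.length = p / k)) := by
  simp only [misfit, eval_eqTest, Expr.eval_mul, Expr.eval_add, Expr.eval_mod, Expr.eval_div,
    Expr.eval_shiftRight, Expr.eval_pow, Expr.eval_lit, Expr.eval_ofNat, Expr.eval_var,
    var_tests_prepared, eval_colours, eval_position hf he, eval_source hf he]
  rw [← digit, ← bitTest]
  have hbit (d v) : bitTest d v = 0 ∨ bitTest d v = 1 := Nat.mod_two_eq_zero_or_one _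
  rcases hbit (digit (numTests x.edges.length) (s % numColours k x.edges.length) p)
    (IsTable.num x f x.edges[e].1) with h | h <;> rw [h] <;> split_ifs <;> simp_all

theorem eval_misfits_eq_zero_iff (he : e < x.edges.length) :
    (misfits k).eval (prepared x f l (s * x.edges.length + e)) = 0 ↔
      Admits k (numTests x.edges.length) (s % numColours k x.edges.length)
        (s / numColours k x.edges.length) (IsTable.num x f x.edges[e].1) := by
  simp only [misfits, Expr.eval_sum, List.sum_eq_zero_iff, List.mem_map, List.mem_range,
    forall_exists_index, and_imp, forall_apply_eq_imp_iff₂, Admits,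
    eval_misfit_eq_zero_iff hf _ he]

theorem map_eval_arcExprs (he : e < x.edges.length) :
    (arcExprs k).map (Expr.eval (prepared x f l (s * x.edges.length + e))) =
      [(colouredArc x k (IsTable.num x f) s x.edges[e]).1, 1,
        (colouredArc x k (IsTable.num x f) s x.edges[e]).2] := by
  have hbad : 1 - (1 - (misfits k).eval (prepared x f l (s * x.edges.length + e))) =
      if Admits k (numTests x.edges.length) (s % numColours k x.edges.length)
        (s / numColours k x.edges.length) (IsTable.num x f x.edges[e].1) then 0 else 1 := by
    split_ifs with h
    · rw [(eval_misfits_eq_zero_iff hf he).2 h]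
    · have := mt (eval_misfits_eq_zero_iff (l := l) hf he).1 h
      omega
  simp only [arcExprs, List.map_cons, List.map_nil, Expr.eval_add, Expr.eval_sub, Expr.eval_mul,
    Expr.eval_lit, Expr.eval_ofNat, eval_position hf he, eval_source hf he, eval_target hf he,
    eval_radix hf, eval_colours, eval_coloured hf, hbad, ite_mul, zero_mul, one_mul, colouredArc]

theorem map_eval_chainExprs :
    (chainExprs k).map (Expr.eval (prepared x f l i)) =
      [i, 0, i + 1, k * layerWidth k x.edges.length + (i + 1), 2,
        k * layerWidth k x.edges.length + i] := by
  simp only [chainExprs, List.map_cons, List.map_nil, Expr.eval_add, Expr.eval_mul, Expr.eval_lit,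
    Expr.eval_ofNat, Expr.eval_var, var_idx_prepared, eval_coloured hf]

theorem map_eval_headerExprs {γ : ℚ} (hγ : 0 < γ) {n t : ℕ}
    (hn : n = (2 * k + 2 + γ.den) * layerWidth k x.edges.length)
    (ht : t = (layerWidth k x.edges.length - 1) * 2 +
      k * numColours k x.edges.length * x.edges.length) :
    (headerExprs k γ).map (Expr.eval (prepared x f l i)) =
      [n, t, 0, linearBound γ (n + t), k * layerWidth k x.edges.length,
        linearBound γ (n + t)] := by
  simp only [headerExprs, List.map_cons, List.map_nil, Expr.eval_add, Expr.eval_sub, Expr.eval_mul,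
    Expr.eval_div, Expr.eval_lit, Expr.eval_ofNat, eval_colours, eval_coloured hf,
    eval_numEdges hf, linearBound_eq_div hγ, hn, ht]

theorem eval_start : start.eval (prepared x f l i) = outputStart x := by
  simp only [start, Expr.eval_add, Expr.eval_mul, Expr.eval_load, Expr.eval_ofNat,
    eval_numEdges hf]
  rw [mem_prepared (by rw [outputStart]; omega), hf.zero_eq, outputStart]

end OutputExpressions

/-! ## The reduction -/

section Reduction

theorem flatMap_range_mul {α β : Type*} {l : List α} {g : ℕ → α → List β} {A : ℕ → List β}
    (h : ∀ s e (he : e < l.length), A (s * l.length + e) = g s l[e]) (N : ℕ) :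
    (List.range N).flatMap (fun s => l.flatMap (g s)) = (List.range (N * l.length)).flatMap A := by
  induction N with
  | zero => simp
  | succ N ih =>
    have hlast : l.map (g N) = (List.range l.length).map fun e => A (N * l.length + e) :=
      List.ext_getElem (by simp) fun e he _ => by simpa using (h N e (by simpa using he)).symm
    rw [List.range_succ, Nat.succ_mul, List.range_add, List.flatMap_append, List.flatMap_append, ih,
      List.flatMap_singleton, List.flatMap_map]
    exact congrArg _ (congrArg List.flatten hlast)

/-- Write the instance of the VASS problem for the coloured graph. -/
def emitInstance (k : ℕ) (γ : ℚ) : Cmd Var :=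
  .seq (emit (headerExprs k γ)) <|
    .seq (.forRange .idx (coloured k - 1) (emit (chainExprs k))) <|
      .forRange .idx (.lit k * colours k * numEdges) (emit (arcExprs k))

/-- The running time of `emitInstance` for each coloured vertex. -/
def emitInstanceTime (k : ℕ) (γ : ℚ) : ℕ :=
  let chainTime := (coloured k - 1).len + emitTime (chainExprs k) + 8
  let arcTime := (.lit k * colours k * numEdges : Expr Var).len + emitTime (arcExprs k) + 8
  emitTime (headerExprs k γ) + chainTime + (k + 1) * arcTime

/-- Write the instance of the VASS problem for the coloured graph to the memory, behind the input
graph and the table. -/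
def reduction (k : ℕ) (γ : ℚ) : Cmd Var :=
  .seq numberVertices <| .seq countTests <| .seq (.assign .ptr start) <|
    .seq (emitInstance k γ) (.assign .ptr start)

variable {x : GraphInput} {f : ℕ → ℕ} {k c : ℕ} {γ : ℚ}

/-- The output of the reduction. -/
def output (hk : 0 < k) (γ : ℚ) (hf : IsTable x (2 * x.edges.length) f) : List ℕ :=
  ((colouredGraph x hk γ.den hf.isNumbering).vassInput γ).encode

theorem output_eq (hk : 0 < k) (hγ : 0 < γ) (hf : IsTable x (2 * x.edges.length) f) :
    output hk γ hf = (headerExprs k γ).map (Expr.eval (prepared x f [] 0)) ++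
      (List.range (layerWidth k x.edges.length - 1)).flatMap
        (fun i => (chainExprs k).map (Expr.eval (prepared x f [] i))) ++
      (List.range (k * numColours k x.edges.length * x.edges.length)).flatMap
        fun i => (arcExprs k).map (Expr.eval (prepared x f [] i)) := by
  rw [output, LayeredGraph.encode_vassInput, map_eval_headerExprs hf hγ rfl rfl,
    ← flatMap_range_mul (g := fun s e => [(colouredArc x k (IsTable.num x f) s e).1, 1,
      (colouredArc x k (IsTable.num x f) s e).2]) fun _ _ he => map_eval_arcExprs hf he]
  simp only [map_eval_chainExprs hf, LayeredGraph.triples, LayeredGraph.vassSize, colouredGraph,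
    length_colouredArcs]
  simp [colouredArcs, List.flatMap_assoc, List.flatMap_map]

theorem numColours_mul_le (k m : ℕ) : k * numColours k m * m ≤ k * layerWidth k m := by
  rw [layerWidth, Nat.mul_assoc]
  gcongr
  omega

theorem add_mul_add_succ_mul_le {G N : ℕ} (hG : 0 < G) (hN : N ≤ k * G) (h a b : ℕ) :
    h + (G * a + (N + 1) * b) ≤ (h + a + (k + 1) * b) * G := by
  have h1 : h ≤ h * G := Nat.le_mul_of_pos_right h hG
  have h2 : (N + 1) * b ≤ (k + 1) * G * b := Nat.mul_le_mul_right b (by linarith)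
  linarith

theorem ends_emitInstance (hk : 0 < k) (hγ : 0 < γ) (hf : IsTable x (2 * x.edges.length) f)
    (hfull : outputStart x + (output hk γ hf).length < 2 ^ c)
    (hword : ∀ v ∈ output hk γ hf, v < 2 ^ c) (hwidth : layerWidth k x.edges.length < 2 ^ c)
    (harcs : k * numColours k x.edges.length * x.edges.length < 2 ^ c) (i : ℕ) :
    (emitInstance k γ).Ends c (emitInstanceTime k γ * layerWidth k x.edges.length)
      (prepared x f [] i) fun τ => ∃ j, τ = prepared x f (output hk γ hf) j := by
  have heq := output_eq hk hγ hf
  set full := output hk γ hf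
  have hheader := ends_emit (es := headerExprs k γ) (f := f) (D := numTests x.edges.length)
    (i := i) (l := []) hfull hword
    (fun l => (map_eval_headerExprs hf hγ rfl rfl).trans (map_eval_headerExprs hf hγ rfl rfl).symm)
    ⟨_, (List.append_assoc _ _ _).symm.trans heq.symm⟩
  have hchain := ends_forRange_emit (e := coloured k - 1) (es := chainExprs k) (i := i)
    (l := [] ++ (headerExprs k γ).map (Expr.eval (prepared x f [] 0))) hfull hword
    ((Nat.sub_le _ 1).trans_lt hwidth)
    (fun l i => congrArg (· - 1) (eval_coloured hf))
    (fun i _ l => (map_eval_chainExprs hf).trans (map_eval_chainExprs hf (l := [])).symm)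
    ⟨_, heq.symm⟩
  have hlast := ends_forRange_emit (e := .lit k * colours k * numEdges) (es := arcExprs k)
    (D := numTests x.edges.length) (f := f)
    (g := fun i => (arcExprs k).map (Expr.eval (prepared x f [] i)))
    (i := layerWidth k x.edges.length - 1) hfull hword harcs (fun l i => ?_) (fun i hi l => ?_)
    ⟨[], by rw [List.append_nil, heq]⟩
  · refine (hheader.seq fun _ hτ => hτ ▸ hchain.seq fun _ hτ => hτ ▸ hlast).mono ?_
      fun τ hτ => ⟨_, hτ.trans (by rw [heq]; rfl)⟩
    have hG := one_lt_layerWidth hk x.edges.length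
    rw [Nat.sub_add_cancel hG.le]
    exact add_mul_add_succ_mul_le hG.pos (numColours_mul_le k x.edges.length) _ _ _
  · exact congrArg₂ (· * ·) (congrArg (k * ·) eval_colours) (eval_numEdges hf)
  · obtain ⟨s, e, he, rfl⟩ : ∃ s e, e < x.edges.length ∧ i = s * x.edges.length + e :=
      ⟨i / x.edges.length, i % x.edges.length,
        Nat.mod_lt _ (Nat.pos_of_lt_mul_left hi), (Nat.div_add_mod' _ _).symm⟩
    exact (map_eval_arcExprs hf he).trans (map_eval_arcExprs hf he (l := [])).symm

theorem ends_assign_start (hf : IsTable x (2 * x.edges.length) f) (hc : outputStart x < 2 ^ c)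
    {l : List ℕ} {σ : Store Var} (hmem : σ.mem = layout f (outputStart x) l) :
    (Cmd.assign .ptr start).Ends c 10 σ (· = σ.set .ptr (outputStart x)) := by
  have hstart : start.eval σ = outputStart x := by
    have hσ : start.eval σ = start.eval (prepared x f l 0) := by
      simp [start, numEdges, hmem, prepared, stage]
    rw [hσ, eval_start hf]
  refine Cmd.ends_assign ?_ ?_
  · rwa [hstart]
  · rw [hstart]

end Reduction

end CycleReduction

/-! ## Sizes of the words -/

namespace BoundedVASSInput

variable {B : ℕ → ℕ} {d : ℕ} (y : BoundedVASSInput B d)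

theorem length_transList : y.transList.length = y.vass.trans.card := by
  classical
  rw [← List.toFinset_card_of_nodup y.nodup]
  congr
  ext t
  simp [y.mem_transList]

theorem length_encode : y.encode.length = (d + 2) * (y.transList.length + 2) := by
  simp [encode]
  ring

theorem card_trans_lt_size : y.vass.trans.card < y.vass.size := by
  have := y.source.1.pos
  rw [UnaryVASS.size, Fintype.card_fin]
  omega

theorem numStates_lt_size : y.numStates < y.vass.size := by
  have := y.vass.nonempty.card_pos
  rw [UnaryVASS.size, Fintype.card_fin]
  omega

theorem foldr_max_encode_le :
    y.encode.foldr max 0 ≤ max y.vass.size (B y.vass.size) := by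
  have hstate (q : Fin y.numStates) : (q : ℕ) ≤ max y.vass.size (B y.vass.size) :=
    le_max_of_le_left (q.2.trans y.numStates_lt_size).le
  refine List.max_le_of_forall_le _ _ fun v hv => ?_
  simp only [encode, List.mem_append, List.mem_cons, List.mem_ofFn, List.mem_flatMap,
    List.not_mem_nil, or_false] at hv
  obtain (((rfl | rfl) | rfl | ⟨i, rfl⟩) | rfl | ⟨i, rfl⟩) | ⟨t, ht, rfl | ⟨i, rfl⟩ | rfl⟩ := hv
  · exact le_max_of_le_left y.numStates_lt_size.le
  · exact le_max_of_le_left (y.length_transList.trans_le y.card_trans_lt_size.le)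
  · exact hstate _
  · exact le_max_of_le_right (y.source_le i)
  · exact hstate _
  · exact le_max_of_le_right (y.target_le i)
  · exact hstate _
  · have htwo : 2 ≤ y.vass.size :=
      (Nat.succ_le_succ y.vass.nonempty.card_pos).trans y.card_trans_lt_size
    have := y.vass.unary t ((y.mem_transList t).1 ht) i
    exact le_max_of_le_left (by omega)
  · exact hstate _

theorem length_add_foldr_max_encode_le :
    y.encode.length + y.encode.foldr max 0 ≤
      (2 * d + 5) * y.vass.size + B y.vass.size := by
  have hlength : y.transList.length + 2 ≤ 2 * y.vass.size := by
    have := y.card_trans_lt_size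
    have := y.vass.nonempty.card_pos
    rw [y.length_transList]
    omega
  calc y.encode.length + y.encode.foldr max 0
      ≤ (d + 2) * (2 * y.vass.size) + (y.vass.size + B y.vass.size) := by
        rw [y.length_encode]
        gcongr
        exact y.foldr_max_encode_le.trans (max_le_add_of_nonneg (Nat.zero_le _) (Nat.zero_le _))
    _ = (2 * d + 5) * y.vass.size + B y.vass.size := by ring

end BoundedVASSInput

namespace CycleReduction

open WordRAM

section Sizes

/-- A bound, for each coloured vertex, on the sizes of all numbers that occur in `reduction`. -/
def wordFactor (k : ℕ) (γ : ℚ) : ℕ := (γ.num.toNat + 7) * (3 * k + 4 + γ.den)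

variable {x : GraphInput} {f : ℕ → ℕ} {k : ℕ} {γ : ℚ}

/-- The size of the VASS for a graph with `m` edges. -/
def reducedSize (k q m : ℕ) : ℕ :=
  (2 * k + 2 + q) * layerWidth k m + ((layerWidth k m - 1) * 2 + k * numColours k m * m)

theorem reducedSize_le (k q m : ℕ) : reducedSize k q m ≤ (3 * k + 4 + q) * layerWidth k m := by
  have := numColours_mul_le k m
  have hsplit : (3 * k + 4 + q) * layerWidth k m =
      (2 * k + 2 + q) * layerWidth k m + (layerWidth k m * 2 + k * layerWidth k m) := by ring
  rw [reducedSize]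
  omega

theorem vassSize_colouredGraph (hk : 0 < k) (q : ℕ) {num : Fin x.numVertices → ℕ}
    (hnum : IsNumbering x num) :
    (colouredGraph x hk q hnum).vassSize = reducedSize k q x.edges.length := by
  simp only [LayeredGraph.vassSize, colouredGraph, length_colouredArcs, reducedSize]

theorem length_add_foldr_max_output_le (hk : 0 < k) (hγ : 0 < γ)
    (hf : IsTable x (2 * x.edges.length) f) :
    (output hk γ hf).length + (output hk γ hf).foldr max 0 ≤
      wordFactor k γ * layerWidth k x.edges.length := by
  set V := colouredGraph x hk γ.den hf.isNumbering
  have hsize : (V.vassInput γ).vass.size = V.vassSize := V.size_vass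
  calc (output hk γ hf).length + (output hk γ hf).foldr max 0
      ≤ (2 * 1 + 5) * V.vassSize + linearBound γ V.vassSize :=
        hsize ▸ (V.vassInput γ).length_add_foldr_max_encode_le
    _ ≤ (γ.num.toNat + 7) * V.vassSize := by
        have := Nat.div_le_self (γ.num.toNat * V.vassSize) γ.den
        rw [linearBound_eq_div hγ]
        linarith
    _ ≤ (γ.num.toNat + 7) * ((3 * k + 4 + γ.den) * layerWidth k x.edges.length) := by
        gcongr
        rw [vassSize_colouredGraph]
        exact reducedSize_le k γ.den _
    _ = wordFactor k γ * layerWidth k x.edges.length := by rw [wordFactor, Nat.mul_assoc]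

theorem le_wordFactor (k : ℕ) (γ : ℚ) : k + 1 ≤ wordFactor k γ :=
  (by omega : k + 1 ≤ 3 * k + 4 + γ.den).trans (Nat.le_mul_of_pos_left _ (by omega))

/-- The running time of `reduction` for each coloured vertex. -/
def reductionTime (k : ℕ) (γ : ℚ) : ℕ := emitInstanceTime k γ + 120

theorem reductionTime_bound {m G : ℕ} (hG : 2 * m + 1 ≤ G) (a : ℕ) :
    50 * (m + 1) + (50 * (m + 1) + (10 + (a * G + 10))) ≤ (a + 120) * G := by
  rw [Nat.add_mul]
  omega

theorem set_ptr_eq_prepared (hf : IsTable x (2 * x.edges.length) f) {τ : Store Var}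
    (hmem : τ.mem = f) (htests : τ.var .tests = numTests x.edges.length) :
    τ.set .ptr (outputStart x) = prepared x f [] (τ.var .idx) := by
  have hvar : Function.update τ.var .ptr (outputStart x) =
      (prepared x f [] (τ.var .idx)).var := by
    funext v
    cases v
    · simp [prepared, stage]
    · simp [prepared, stage, htests]
    · simp [prepared, stage]
  simp only [Store.set, hvar, hmem]
  simp only [prepared, stage, hf.layout_nil]

theorem numTests_le_layerWidth {k : ℕ} (hk : 0 < k) (m : ℕ) : numTests m ≤ layerWidth k m :=
  (Nat.le_self_pow (Nat.mul_pos hk hk).ne' _).trans (Nat.le_mul_of_pos_right _ (by omega))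

/-- The reduction ends with the output behind the input and the table. -/
def IsReduced (hk : 0 < k) (γ : ℚ) (x : GraphInput) (τ : Store Var) : Prop :=
  ∃ (f : ℕ → ℕ) (hf : IsTable x (2 * x.edges.length) f), τ.var .ptr = outputStart x ∧
    ∀ i, τ.mem (outputStart x + i) = (output hk γ hf).getD i 0

theorem ends_emitInstance_seq (hk : 0 < k) (hγ : 0 < γ) {c : ℕ}
    (hc : outputStart x + wordFactor k γ * layerWidth k x.edges.length < 2 ^ c)
    (hf : IsTable x (2 * x.edges.length) f) (i : ℕ) :
    (Cmd.seq (emitInstance k γ) (.assign .ptr start)).Ends c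
      (emitInstanceTime k γ * layerWidth k x.edges.length + 10) (prepared x f [] i)
      (IsReduced hk γ x) := by
  have hsize := length_add_foldr_max_output_le hk hγ hf
  have hG : (k + 1) * layerWidth k x.edges.length ≤ wordFactor k γ * layerWidth k x.edges.length :=
    Nat.mul_le_mul_right _ (le_wordFactor k γ)
  rw [Nat.succ_mul] at hG
  have hword (v) (hv : v ∈ output hk γ hf) : v < 2 ^ c := by
    have := List.le_max_of_le' 0 hv le_rfl
    omega
  refine (ends_emitInstance hk hγ hf (by omega) hword (by omega)
    ((numColours_mul_le k _).trans_lt (by omega)) i).seq ?_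
  rintro _ ⟨j, rfl⟩
  refine (ends_assign_start hf (by omega) (l := output hk γ hf) rfl).mono le_rfl ?_
  rintro _ rfl
  refine ⟨f, hf, by simp only [Store.set, Function.update_self], fun a => ?_⟩
  simp [Store.set, prepared, stage, layout]

theorem ends_reduction (hk : 0 < k) (hγ : 0 < γ) {c : ℕ}
    (hc : outputStart x + wordFactor k γ * layerWidth k x.edges.length < 2 ^ c) {σ : Store Var}
    (hσ : σ.mem = fun a => x.encode.getD a 0) :
    (reduction k γ).Ends c (reductionTime k γ * layerWidth k x.edges.length) σ
      (IsReduced hk γ x) := by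
  have hstart : outputStart x < 2 ^ c := (Nat.le_add_right _ _).trans_lt hc
  have hwidth : layerWidth k x.edges.length < 2 ^ c :=
    ((Nat.le_mul_of_pos_left _ ((Nat.succ_pos k).trans_le (le_wordFactor k γ))).trans
      (Nat.le_add_left _ _)).trans_lt hc
  have hm : 2 * x.edges.length + 1 ≤ layerWidth k x.edges.length :=
    Nat.le_mul_of_pos_left _ (zero_lt_one.trans (one_lt_numColours hk _))
  refine ((ends_numberVertices hstart hσ).seq fun τ hf => (ends_countTests (hm.trans_lt hwidth)
    ((numTests_le_layerWidth hk _).trans_lt hwidth) hf.one_eq).seq fun τ' hτ' =>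
    (ends_assign_start hf hstart (hτ'.1.trans hf.layout_nil.symm)).seq fun ρ hρ => ?_).mono
      (reductionTime_bound hm (emitInstanceTime k γ)) fun _ h => h
  rw [hρ, set_ptr_eq_prepared hf hτ'.1 hτ'.2]
  exact ends_emitInstance_seq hk hγ hc hf _

end Sizes

end CycleReduction

namespace WordRAM

section Composition

variable {V : Type*}

/-- The store in the initial state. -/
def Store.initial (V : Type*) (L : List ℕ) : Store V := ⟨fun _ => 0, fun a => L.getD a 0⟩

theorem Store.initial_bounded {c : ℕ} {L : List ℕ} (hL : ∀ v ∈ L, v < 2 ^ c) :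
    (Store.initial V L).Bounded c where
  var_lt _ := Nat.two_pow_pos c
  mem_lt a := by
    by_cases ha : a < L.length
    · simpa [Store.initial, ha] using hL _ (List.getElem_mem ha)
    · simp [Store.initial, not_lt.1 ha]

variable [Encodable V]

/-- The program that performs `b` and then runs `P` on the memory from the address `p` on. -/
def Cmd.compileThen (b : Cmd V) (p : V) (P : Program) : Program :=
  b.compile 0 ++ P.shift b.len (varReg p) (tmpReg 0)

theorem Cmd.Ends.run_compileThen [DecidableEq V] {b : Cmd V} {c s β w w' n : ℕ} {p : V}
    {L L' : List ℕ} {P : Program} {x : Bool} (hL : ∀ v ∈ L, v < 2 ^ c)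
    (h : b.Ends c s (Store.initial V L) fun τ =>
      τ.var p = β ∧ ∀ a, τ.mem (β + a) = L'.getD a 0)
    (hb : b.bits c ≤ w') (hw : β + 2 ^ w ≤ 2 ^ w') (hP : run P w n (initial L') = some x) :
    run (b.compileThen p P) w' (s + 2 * n) (initial L) = some x := by
  obtain ⟨t, ht, τ, hexec, hp, hmem⟩ := h
  have hcode : CodeAt (b.compileThen p P) 0 (b.compileThen p P) := List.prefix_refl _
  obtain ⟨r, hr, hodd, hlead⟩ :=
    leads_compile hexec hcode.left hb (Store.initial_bounded hL) (r := fun _ => 0) fun _ => rfl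
  rw [Nat.zero_add] at hlead
  have hrep : Represents (varReg p) β w (initial L') ⟨b.len, r, τ.mem⟩ :=
    ⟨hodd, (hr p).trans hp, hmem, fun _ => Nat.two_pow_pos w⟩
  have hright : CodeAt (b.compileThen p P) b.len (P.shift b.len (varReg p) (tmpReg 0)) := by
    simpa only [b.length_compile, Nat.zero_add] using hcode.right
  refine run_mono (Nat.add_le_add_right ht _) ((hlead _).trans ?_)
  exact hrep.run ⟨2 * Encodable.encode p, by rw [varReg]; ring⟩ (by decide)
    (varReg_ne_tmpReg p 0).symm hw hright rfl hP

end Composition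

end WordRAM

namespace CycleReduction

open WordRAM

section Solution

variable {x : GraphInput} {k : ℕ} {γ : ℚ}

theorem outputStart_lt (x : GraphInput) : outputStart x < 2 ^ inputBits x.encode := by
  refine lt_of_le_of_lt ?_ (Nat.lt_size_self _)
  rw [outputStart, length_encode]
  exact Nat.add_le_add_left (le_max_left _ _) _

theorem lt_of_mem_encode {v : ℕ} (hv : v ∈ x.encode) : v < 2 ^ inputBits x.encode :=
  ((List.le_max_of_le' 0 hv le_rfl).trans (Nat.le_add_left _ _)).trans_lt (Nat.lt_size_self _)

theorem inputBits_encode_pos (x : GraphInput) : 0 < inputBits x.encode :=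
  Nat.size_pos.2 (by rw [length_encode]; omega)

theorem numColours_lt {m b : ℕ} (hk : 0 < k) (hm : 2 * m + 1 < 2 ^ b) :
    numColours k m < 2 ^ (2 * (k * k) * b) := by
  have hb : (2 * m + 1).size ≤ b := Nat.size_le.2 hm
  have htests : numTests m < 2 ^ (2 * b) :=
    (Nat.mul_le_mul_left 2 hb).trans_lt Nat.lt_two_pow_self
  calc numColours k m < (2 ^ (2 * b)) ^ (k * k) :=
        Nat.pow_lt_pow_left htests (Nat.mul_pos hk hk).ne'
    _ = 2 ^ (2 * (k * k) * b) := by rw [← Nat.pow_mul, Nat.mul_right_comm]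

/-- The length of the words that `reduction` needs, as a multiple of the length of the words of the
input. -/
def wordLength (k : ℕ) (γ : ℚ) : ℕ := 1 + (wordFactor k γ + (2 * (k * k) + 1))

theorem outputStart_add_lt (hk : 0 < k) (γ : ℚ) (x : GraphInput) :
    outputStart x + wordFactor k γ * layerWidth k x.edges.length <
      2 ^ (wordLength k γ * inputBits x.encode) := by
  have hb := inputBits_encode_pos x
  have hstart := outputStart_lt x
  set b := inputBits x.encode
  have hm : 2 * x.edges.length + 1 < 2 ^ b := by
    rw [outputStart] at hstart
    omega
  have hfactor : wordFactor k γ < 2 ^ (wordFactor k γ * b) :=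
    (Nat.le_mul_of_pos_right _ hb).trans_lt Nat.lt_two_pow_self
  have hwidth : layerWidth k x.edges.length < 2 ^ (2 * (k * k) * b + b) :=
    BinOp.eval_lt (o := .mul) nofun (numColours_lt hk hm) hm
  have hsum := BinOp.eval_lt (o := .add) nofun hstart
    (BinOp.eval_lt (o := .mul) nofun hfactor hwidth)
  have hlength : b + (wordFactor k γ * b + (2 * (k * k) * b + b)) = wordLength k γ * b := by
    rw [wordLength]
    ring
  exact hsum.trans_eq (congrArg _ hlength)

theorem inputBits_output_le (hk : 0 < k) (hγ : 0 < γ) {f : ℕ → ℕ}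
    (hf : IsTable x (2 * x.edges.length) f) :
    inputBits (output hk γ hf) ≤ wordLength k γ * inputBits x.encode :=
  Nat.size_le.2 <| (length_add_foldr_max_output_le hk hγ hf).trans_lt <|
    (Nat.le_add_left _ _).trans_lt (outputStart_add_lt hk γ x)

theorem outputStart_add_two_pow_le {M c w : ℕ} (hw : w ≤ M * inputBits x.encode) (d : ℕ) :
    outputStart x + 2 ^ (c * w) ≤ 2 ^ ((d + (c * M + 2)) * inputBits x.encode) := by
  have hsum := BinOp.eval_lt (o := .add) nofun (outputStart_lt x)
    (Nat.pow_lt_pow_succ (n := c * w) one_lt_two)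
  have hlength : inputBits x.encode + (c * w + 1) ≤ (d + (c * M + 2)) * inputBits x.encode :=
    calc inputBits x.encode + (c * w + 1)
        ≤ inputBits x.encode + (c * (M * inputBits x.encode) + inputBits x.encode) := by
          gcongr
          exact inputBits_encode_pos x
      _ = (c * M + 2) * inputBits x.encode := by ring
      _ ≤ (d + (c * M + 2)) * inputBits x.encode :=
          Nat.mul_le_mul_right _ (Nat.le_add_left _ _)
  exact hsum.le.trans (Nat.pow_le_pow_right two_pos hlength)

/-- The length of the words for `reduction` followed by a program with words of `c` times the length
of the words of its input, as a multiple of the length of the words of the input. -/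
def composedWordLength (k : ℕ) (γ : ℚ) (c : ℕ) : ℕ :=
  (reduction k γ).bits 1 * wordLength k γ + (c * wordLength k γ + 2)

theorem exists_run_compileThen (hk : 0 < k) (hγ : 0 < γ) (x : GraphInput) (P : Program) (c : ℕ) :
    ∃ (f : ℕ → ℕ) (hf : IsTable x (2 * x.edges.length) f), ∀ (n : ℕ) (answer : Bool),
      run P (c * inputBits (output hk γ hf)) n (initial (output hk γ hf)) = some answer →
      run ((reduction k γ).compileThen .ptr P)
        (composedWordLength k γ c * inputBits x.encode)
        (reductionTime k γ * layerWidth k x.edges.length + 2 * n) (initial x.encode) =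
          some answer := by
  obtain ⟨t, ht, τ, hexec, f, hf, hptr, hmem⟩ :=
    ends_reduction hk hγ (outputStart_add_lt hk γ x) (σ := Store.initial Var x.encode) rfl
  have hword : 1 ≤ wordLength k γ := Nat.le_add_right _ _
  have hpos := inputBits_encode_pos x
  have hinput (v) (hv : v ∈ x.encode) : v < 2 ^ (wordLength k γ * inputBits x.encode) :=
    (lt_of_mem_encode hv).trans_le
      (Nat.pow_le_pow_right two_pos (Nat.le_mul_of_pos_left _ hword))
  have hbits : (reduction k γ).bits (wordLength k γ * inputBits x.encode) ≤
      composedWordLength k γ c * inputBits x.encode := by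
    refine ((reduction k γ).bits_le (Nat.mul_pos hword hpos)).trans ?_
    rw [← Nat.mul_assoc]
    exact Nat.mul_le_mul_right _ (Nat.le_add_right _ _)
  exact ⟨f, hf, fun n answer hrun => Cmd.Ends.run_compileThen hinput
    ⟨t, ht, τ, hexec, hptr, hmem⟩ hbits
    (outputStart_add_two_pow_le (inputBits_output_le hk hγ hf) _) hrun⟩

theorem solvableInTime_kCycle (hk : 0 < k) (hγ : 0 < γ)
    {yes : BoundedVASSInput (linearBound γ) 1 → Prop}
    (hreach : ∀ y, (reachabilityProblem (linearBound γ) 1).yes y → yes y)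
    (hcover : ∀ y, yes y → (coverabilityProblem (linearBound γ) 1).yes y) {T : ℕ → ℕ}
    (h : (DecisionProblem.mk (BoundedVASSInput (linearBound γ) 1) BoundedVASSInput.encode
      (fun y => y.vass.size) yes).SolvableInTime T) :
    (kCycleProblem k).SolvableInTime fun m =>
      reductionTime k γ * layerWidth k m + 2 * T (reducedSize k γ.den m) := by
  obtain ⟨P, c, hP⟩ := h
  refine ⟨(reduction k γ).compileThen .ptr P, composedWordLength k γ c, fun x => ?_⟩
  obtain ⟨f, hf, htransfer⟩ := exists_run_compileThen hk hγ x P c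
  let L := colouredGraph x hk γ.den hf.isNumbering
  have hsize : (L.vassInput γ).vass.size = reducedSize k γ.den x.edges.length :=
    L.size_vass.trans (vassSize_colouredGraph hk _ _)
  obtain ⟨answer, hrun, hanswer⟩ := hP (L.vassInput γ)
  simp only [hsize] at hrun
  refine ⟨answer, htransfer _ _ hrun, hanswer.trans ⟨fun hyes => ?_, fun hcycle => ?_⟩⟩
  · exact hasKCycle_of_hasClosedWalk hk _ _ (L.hasClosedWalk_of_coverability (hcover _ hyes))
  · refine hreach _ ((hasClosedWalk_of_hasKCycle hk _ _ hcycle).reachability hγ ?_)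
    exact Nat.mul_le_mul_right _ (Nat.le_add_left _ _)

theorem solvableInTime_zeroCycle : (kCycleProblem 0).SolvableInTime fun _ => 1 :=
  ⟨[.accept], 0, fun _ => ⟨true, rfl, by
    simp only [true_iff]
    exact ⟨fun i => i.elim0, fun i => i.elim0, fun i => i.elim0⟩⟩⟩

end Solution

/-! ## Running times -/

section RunningTime

open Asymptotics Filter

variable {k : ℕ} {γ : ℚ} {δ ε a b : ℝ}

theorem isBigO_natCast_rpow (hab : a ≤ b) :
    (fun n : ℕ => (n : ℝ) ^ a) =O[atTop] fun n : ℕ => (n : ℝ) ^ b := by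
  refine .of_norm_eventuallyLE ?_
  filter_upwards [eventually_ge_atTop 1] with n hn
  rw [Real.norm_of_nonneg (by positivity)]
  exact Real.rpow_le_rpow_of_exponent_le (Nat.one_le_cast.2 hn) hab

theorem isBigO_size_log : (fun n : ℕ => (n.size : ℝ)) =O[atTop] fun n : ℕ => Real.log n := by
  refine .of_bound (2 / Real.log 2) ?_
  filter_upwards [eventually_ge_atTop 2] with n hn
  have hpow : 2 ^ n.size ≤ n ^ 2 := by
    obtain ⟨s, hs⟩ := Nat.exists_eq_succ_of_ne_zero (Nat.size_pos.2 (two_pos.trans_le hn)).ne'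
    rw [hs, Nat.pow_succ, Nat.pow_two]
    exact Nat.mul_le_mul (Nat.lt_size.1 (hs ▸ s.lt_succ_self)) hn
  have hlog : n.size * Real.log 2 ≤ 2 * Real.log n := by
    have hpow : (2 : ℝ) ^ n.size ≤ (n : ℝ) ^ 2 := mod_cast hpow
    simpa only [Real.log_pow, Nat.cast_ofNat] using Real.le_log_of_pow_le two_pos hpow
  rw [Real.norm_of_nonneg (Nat.cast_nonneg _), Real.norm_of_nonneg (Real.log_natCast_nonneg n),
    div_mul_eq_mul_div]
  exact (le_div_iff₀ (Real.log_pos one_lt_two)).2 hlog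

theorem isBigO_size_pow (K : ℕ) (hδ : 0 < δ) :
    (fun n : ℕ => (n.size : ℝ) ^ K) =O[atTop] fun n : ℕ => (n : ℝ) ^ δ := by
  have hlog := (isLittleO_log_rpow_rpow_atTop (K : ℝ) hδ).isBigO.comp_tendsto
    tendsto_natCast_atTop_atTop
  simp only [Real.rpow_natCast] at hlog
  exact (isBigO_size_log.pow K).trans hlog

theorem isBigO_layerWidth (k : ℕ) (hδ : 0 < δ) :
    (fun m => (layerWidth k m : ℝ)) =O[atTop] fun m : ℕ => (m : ℝ) ^ (1 + δ) := by
  have hatTop : Tendsto (fun m : ℕ => 2 * m + 1) atTop atTop :=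
    tendsto_atTop_mono (fun m => (by omega : m ≤ 2 * m + 1)) tendsto_id
  have hlinear : (fun m : ℕ => ((2 * m + 1 : ℕ) : ℝ)) =O[atTop] fun m : ℕ => (m : ℝ) := by
    refine .of_bound 3 ?_
    filter_upwards [eventually_ge_atTop 1] with m hm
    rw [Real.norm_of_nonneg (Nat.cast_nonneg _), Real.norm_of_nonneg (Nat.cast_nonneg _)]
    exact_mod_cast (by omega : 2 * m + 1 ≤ 3 * m)
  have hsize : (fun m : ℕ => ((2 * m + 1).size : ℝ) ^ (k * k)) =O[atTop]
      fun m : ℕ => (m : ℝ) ^ δ :=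
    ((isBigO_size_pow (k * k) hδ).comp_tendsto hatTop).trans
      (hlinear.rpow hδ.le (.of_forall fun m => m.cast_nonneg))
  refine ((hsize.mul hlinear).const_mul_left (2 ^ (k * k))).congr' (.of_forall fun m => ?_) ?_
  · simp only [layerWidth, numColours, numTests]
    push_cast
    ring
  · filter_upwards [eventually_gt_atTop 0] with m hm
    rw [add_comm, Real.rpow_add_one (Nat.cast_ne_zero.2 hm.ne')]

theorem isBigO_reducedSize (k q : ℕ) (hδ : 0 < δ) :
    (fun m => (reducedSize k q m : ℝ)) =O[atTop] fun m : ℕ => (m : ℝ) ^ (1 + δ) := by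
  refine (IsBigO.of_bound (3 * k + 4 + q : ℕ) (.of_forall fun m => ?_)).trans
    (isBigO_layerWidth k hδ)
  rw [Real.norm_of_nonneg (Nat.cast_nonneg _), Real.norm_of_nonneg (Nat.cast_nonneg _)]
  exact_mod_cast reducedSize_le k q m

theorem tendsto_reducedSize (hk : 0 < k) (q : ℕ) : Tendsto (reducedSize k q) atTop atTop := by
  refine tendsto_atTop_mono (fun m => ?_) tendsto_id
  have hcolours : 1 ≤ numColours k m := (one_lt_numColours hk m).le
  calc m ≤ k * numColours k m * m := Nat.le_mul_of_pos_left m (Nat.mul_pos hk hcolours)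
    _ ≤ reducedSize k q m := (Nat.le_add_left _ _).trans (Nat.le_add_left _ _)

theorem isBigO_time (hk : 0 < k) (c q : ℕ) (hε : 0 < ε) (hε₁ : ε ≤ 1) {T : ℕ → ℕ}
    (hT : (fun n => (T n : ℝ)) =O[atTop] fun n : ℕ => (n : ℝ) ^ (2 - ε)) :
    (fun m => ((c * layerWidth k m + 2 * T (reducedSize k q m) : ℕ) : ℝ)) =O[atTop]
      fun m : ℕ => (m : ℝ) ^ (2 - ε / 2) := by
  have hδ : 0 < ε / 4 := by positivity
  have hwidth : (fun m => (c * layerWidth k m : ℝ)) =O[atTop] fun m : ℕ => (m : ℝ) ^ (2 - ε / 2) :=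
    ((isBigO_layerWidth k hδ).const_mul_left _).trans (isBigO_natCast_rpow (by linarith))
  have hsolve : (fun m => (T (reducedSize k q m) : ℝ)) =O[atTop]
      fun m : ℕ => (m : ℝ) ^ (2 - ε / 2) :=
    calc (fun m => (T (reducedSize k q m) : ℝ))
        =O[atTop] fun m => (reducedSize k q m : ℝ) ^ (2 - ε) :=
          hT.comp_tendsto (tendsto_reducedSize hk q)
      _ =O[atTop] fun m : ℕ => ((m : ℝ) ^ (1 + ε / 4)) ^ (2 - ε) :=
          (isBigO_reducedSize k q hδ).rpow (by linarith) (.of_forall fun m => by positivity)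
      _ =O[atTop] fun m : ℕ => (m : ℝ) ^ (2 - ε / 2) := by
          simp only [← Real.rpow_mul (Nat.cast_nonneg _)]
          exact isBigO_natCast_rpow (by nlinarith)
  simpa only [Nat.cast_add, Nat.cast_mul] using hwidth.add (hsolve.const_mul_left _)

theorem not_solvableInTimeBigO (hypothesis : KCycleHypothesis) (hγ : 0 < γ) (hε : 0 < ε)
    {yes : BoundedVASSInput (linearBound γ) 1 → Prop}
    (hreach : ∀ y, (reachabilityProblem (linearBound γ) 1).yes y → yes y)
    (hcover : ∀ y, yes y → (coverabilityProblem (linearBound γ) 1).yes y) :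
    ¬ (DecisionProblem.mk (BoundedVASSInput (linearBound γ) 1) BoundedVASSInput.encode
      (fun y => y.vass.size) yes).SolvableInTimeBigO (2 - ε) := by
  rintro ⟨T, hT, hsolve⟩
  have hpos : 0 < min ε 1 := lt_min hε one_pos
  have hT' := hT.trans (isBigO_natCast_rpow (sub_le_sub_left (min_le_left ε 1) 2))
  obtain ⟨k, hk⟩ := hypothesis (min ε 1 / 2) (half_pos hpos)
  refine hk ?_
  rcases Nat.eq_zero_or_pos k with rfl | hk
  · refine ⟨fun _ => 1, ?_, solvableInTime_zeroCycle⟩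
    simpa using isBigO_natCast_rpow (a := 0) (by linarith [min_le_right ε 1])
  · exact ⟨_, isBigO_time hk _ γ.den hpos (min_le_right _ _) hT',
      solvableInTime_kCycle hk hγ hreach hcover hsolve⟩

end RunningTime

end CycleReduction

theorem mainTheorem4 (hypothesis : KCycleHypothesis) (γ : ℚ) (hγ : 0 < γ)
    (ε : ℝ) (hε : 0 < ε) :
    ¬ (reachabilityProblem (linearBound γ) 1).SolvableInTimeBigO (2 - ε) ∧
      ¬ (coverabilityProblem (linearBound γ) 1).SolvableInTimeBigO (2 - ε) := by
  have hcover (y) (h : (reachabilityProblem (linearBound γ) 1).yes y) :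
      (coverabilityProblem (linearBound γ) 1).yes y := ⟨y.target.2, fun _ => le_rfl, h⟩
  exact ⟨CycleReduction.not_solvableInTimeBigO hypothesis hγ hε (fun _ h => h) hcover,
    CycleReduction.not_solvableInTimeBigO hypothesis hγ hε hcover fun _ h => h⟩
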